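/- Let $g_1,\dots,g_M$ be real polynomials on $\mathbb{R}^N$ such that $\mathcal{P}=\{\theta\in\mathbb{R}^N: g_i(\theta)\ge 0,\ i=1,\dots,M\}$ is compact. Let $A(\rho)$ be an $n\times n$ real matrix whose entries are polynomials in $\rho\in\mathbb{R}^N$, and let $\lambda(\rho,\theta)$ be a real polynomial such that, for every $\rho\in\mathcal{P}$, $\lambda(\rho,\theta)\ge0$ for almost every $\theta\in\mathcal{P}$. Consider the stochastic hybrid system $$\dot x(t)=A(\rho(t))\,x(t),\qquad x(0)=x_0\in\mathbb{R}^n,\qquad \rho(0)=\rho_0\in\mathcal{P},$$ where $x$ is continuous and $\rho$ is a time-homogeneous Markov process in $\mathcal{P}$ with right-continuous piecewise constant paths (finitely many jumps in bounded time) and jump rates $\lambda(\rho,\theta)\,d\theta$, that is, for every $\rho\in\mathcal{P}$ and every measurable $B\subseteq\mathcal{P}\setminus\{\rho\}$, $$\mathbb{P}[\rho(t+h)\in B\mid\rho(t)=\rho]=h\int_B\lambda(\rho,\theta)\,d\theta+o(h)\qquad(h\downarrow0).$$ A matrix-valued function $F$ on $\mathbb{R}^N$ is called an SOS matrix if $F(\rho)=L(\rho)^{T}L(\rho)$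 for all $\rho\in\mathbb{R}^N$, for some (possibly rectangular) polynomial matrix $L$. Write $\mathrm{He}[X]=X+X^T$. Let $\varepsilon,\alpha>0$ and let $P,\Gamma_1^i,\Gamma_2^i$ ($i=1,\dots,M$) be $n\times n$ symmetric polynomial matrices on $\mathbb{R}^N$ such that (C1) $\Gamma_1^i$ and $\Gamma_2^i$ are SOS matrices for all $i$; (C2) $P(\rho)-\sum_{i=1}^M\Gamma_1^i(\rho)g_i(\rho)-\varepsilon I_n$ is an SOS matrix; (C3) $-\mathrm{He}[P(\rho)A(\rho)]-\int_{\mathcal{P}}\lambda(\rho,\theta)[P(\theta)-P(\rho)]\,d\theta-\sum_{i=1}^M\Gamma_2^i(\rho)g_i(\rho)-2\alpha P(\rho)$ is an SOS matrix. Then, for all $\rho\in\mathcal{P}$, $P(\rho)$ is positive definite and $$\mathrm{He}[P(\rho)A(\rho)]+\int_{\mathcal{P}}\lambda(\rho,\theta)[P(\theta)-P(\rho)]\,d\theta+2\alpha P(\rho)\preceq0.$$ Moreover, the system is mean-square exponentially stable with rate $\alpha$: there is $\beta\ge1$ such that, for all initial conditions $(x_0,\rho_0)\in\mathbb{R}^n\times\mathcal{P}$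 and all $t\ge0$, $\mathbb{E}\|x(t)\|_2^2\le\beta e^{-2\alpha t}\|x_0\|_2^2$. -/

import Mathlib

universe u

open Matrix MeasureTheory ProbabilityTheory Filter Topology

namespace LPVJump

/-- The value at `ρ` of a polynomial matrix. -/
noncomputable def evalMat {N : ℕ} {m k : Type*} (M : Matrix m k (MvPolynomial (Fin N) ℝ))
    (ρ : Fin N → ℝ) : Matrix m k ℝ :=
  M.map (MvPolynomial.eval ρ)

/-- The value `lam(ρ, θ)` of a polynomial in two groups of `N` variables. -/
noncomputable def evalRate {N : ℕ} (lam : MvPolynomial (Fin N ⊕ Fin N) ℝ)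
    (ρ θ : Fin N → ℝ) : ℝ :=
  MvPolynomial.eval (Sum.elim ρ θ) lam

/-- The basic semialgebraic set `{θ ∈ ℝ^N : g_i(θ) ≥ 0, i = 1, …, M}`. -/
def semialgebraicSet {N M : ℕ} (g : Fin M → MvPolynomial (Fin N) ℝ) : Set (Fin N → ℝ) :=
  {θ | ∀ i, 0 ≤ MvPolynomial.eval θ (g i)}

/-- `He[X] = X + Xᵀ`. -/
def He {n : ℕ} (X : Matrix (Fin n) (Fin n) ℝ) : Matrix (Fin n) (Fin n) ℝ :=
  X + Xᵀ

/-- The matrix `∫_S lam(ρ, θ) [P(θ) - P(ρ)] dθ` (entrywise Lebesgue integral). -/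
noncomputable def jumpIntegral {N n : ℕ} (S : Set (Fin N → ℝ))
    (lam : MvPolynomial (Fin N ⊕ Fin N) ℝ)
    (P : (Fin N → ℝ) → Matrix (Fin n) (Fin n) ℝ) (ρ : Fin N → ℝ) :
    Matrix (Fin n) (Fin n) ℝ :=
  Matrix.of fun i j => ∫ θ in S, evalRate lam ρ θ * (P θ i j - P ρ i j)

/-! ### The stochastic system -/

/-- `κ(ρ, B) = ∫_B lam(ρ, θ) dθ` for `B ⊆ S`. -/
noncomputable def jumpRate {N : ℕ} (S : Set (Fin N → ℝ)) (lam : MvPolynomial (Fin N ⊕ Fin N) ℝ)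
    (ρ : S) (B : Set S) : ℝ :=
  ∫ θ in (Subtype.val '' B), evalRate lam ρ θ

/-- `p` is a (time-homogeneous, conservative) Markov transition function on `S` with instantaneous
jump rates `κ(ρ, dθ) = lam(ρ, θ) dθ`: for every `ρ` and every measurable `B ⊆ S \ {ρ}`,
`p_h(ρ, B) = κ(ρ, B) h + o(h)` as `h ↓ 0`. -/
structure IsJumpTransition {N : ℕ} (S : Set (Fin N → ℝ))
    (lam : MvPolynomial (Fin N ⊕ Fin N) ℝ) (p : ℝ → Kernel S S) : Prop where
  markov : ∀ t, 0 ≤ t → IsMarkovKernel (p t)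
  zero : p 0 = Kernel.id
  chapman_kolmogorov : ∀ s t, 0 ≤ s → 0 ≤ t → p (s + t) = p t ∘ₖ p s
  rate : ∀ (ρ : S) (B : Set S), MeasurableSet B → ρ ∉ B →
    (fun h : ℝ => (p h ρ).real B - jumpRate S lam ρ B * h) =o[𝓝[>] (0 : ℝ)] (fun h : ℝ => h)

/-- The σ-algebra generated by `(ρ(r))_{0 ≤ r ≤ s}`. -/
@[reducible]
def past {Ω E : Type*} [MeasurableSpace E] (ρ : ℝ → Ω → E) (s : ℝ) : MeasurableSpace Ω :=
  ⨆ r ∈ Set.Icc (0 : ℝ) s, MeasurableSpace.comap (ρ r) inferInstance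

/-- A right-continuous path on `[0, ∞)` that is piecewise constant, with finitely many jumps on
bounded intervals. -/
def IsPiecewiseConstant {E : Type*} (r : ℝ → E) : Prop :=
  ∃ τ : ℕ → ℝ, τ 0 = 0 ∧ Monotone τ ∧ Tendsto τ atTop atTop ∧
    ∀ k, ∀ t ∈ Set.Ico (τ k) (τ (k + 1)), r t = r (τ k)

/-- `(x(t), ρ(t))_{t ≥ 0}` is a trajectory process, started at `(x₀, ρ₀)`, of the system
`x' = A(ρ) x` without inputs, whose parameter `ρ` is a Markov process in `S` with piecewise
constant paths and instantaneous jump rates `lam(ρ, θ) dθ`. Only times `t ≥ 0` matter.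

Almost surely `x` is continuous and has right derivative `A(ρ(t)) x(t)` at every `t ≥ 0`; as `ρ` is
right-continuous and piecewise constant, this is the differential equation between jumps together
with the absence of jumps in `x`. -/
structure IsTrajectory {N n : ℕ} (S : Set (Fin N → ℝ))
    (A : Matrix (Fin n) (Fin n) (MvPolynomial (Fin N) ℝ))
    (lam : MvPolynomial (Fin N ⊕ Fin N) ℝ)
    (x₀ : EuclideanSpace ℝ (Fin n)) (ρ₀ : S)
    {Ω : Type*} [MeasurableSpace Ω] (μ : Measure Ω)
    (x : ℝ → Ω → EuclideanSpace ℝ (Fin n)) (ρ : ℝ → Ω → S) : Prop where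
  measurable_param : ∀ t, 0 ≤ t → Measurable (ρ t)
  measurable_state : ∀ t, 0 ≤ t → Measurable (x t)
  init_param : ∀ᵐ ω ∂μ, ρ 0 ω = ρ₀
  init_state : ∀ᵐ ω ∂μ, x 0 ω = x₀
  piecewise_constant : ∀ᵐ ω ∂μ, IsPiecewiseConstant (fun t => ρ t ω)
  markov : ∃ p : ℝ → Kernel S S, IsJumpTransition S lam p ∧
    ∀ s h, 0 ≤ s → 0 ≤ h → ∀ B : Set S, MeasurableSet B →
      μ[(ρ (s + h) ⁻¹' B).indicator (fun _ => (1 : ℝ)) | past ρ s]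
        =ᵐ[μ] fun ω => (p h (ρ s ω)).real B
  continuous_state : ∀ᵐ ω ∂μ, ContinuousOn (fun t => x t ω) (Set.Ici 0)
  flow : ∀ᵐ ω ∂μ, ∀ t, 0 ≤ t →
    HasDerivWithinAt (fun s => x s ω)
      (WithLp.toLp 2 (evalMat A (ρ t ω) *ᵥ (x t ω).ofLp)) (Set.Ici t) t

/-- Mean-square exponential stability with rate `α`: there is `β ≥ 1`, uniform in the initial
condition, with `E[‖x(t)‖²] ≤ β e^{-2αt} ‖x(0)‖²` for all `t ≥ 0`. -/
def MeanSquareExpStable {N n : ℕ} (S : Set (Fin N → ℝ))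
    (A : Matrix (Fin n) (Fin n) (MvPolynomial (Fin N) ℝ))
    (lam : MvPolynomial (Fin N ⊕ Fin N) ℝ) (α : ℝ) : Prop :=
  ∃ β : ℝ, 1 ≤ β ∧
    ∀ (Ω : Type u) [MeasurableSpace Ω] (μ : Measure Ω) [IsProbabilityMeasure μ]
      (x₀ : EuclideanSpace ℝ (Fin n)) (ρ₀ : S)
      (x : ℝ → Ω → EuclideanSpace ℝ (Fin n)) (ρ : ℝ → Ω → S),
      IsTrajectory S A lam x₀ ρ₀ μ x ρ →
        ∀ t, 0 ≤ t → Integrable (fun ω => ‖x t ω‖ ^ 2) μ ∧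
          ∫ ω, ‖x t ω‖ ^ 2 ∂μ ≤ β * Real.exp (-2 * α * t) * ‖x₀‖ ^ 2

/-! ### The matrix inequality and the sum of squares program -/

/-- The parameter-dependent Lyapunov conditions for rate `α`: for all `ρ ∈ S`, `P(ρ) ≻ 0` and
`He[P(ρ)A(ρ)] + ∫_S lam(ρ,θ)[P(θ) - P(ρ)]dθ + 2αP(ρ) ⪯ 0` (the integral being well defined). -/
def LyapunovCondition {N n : ℕ} (S : Set (Fin N → ℝ))
    (A : Matrix (Fin n) (Fin n) (MvPolynomial (Fin N) ℝ))
    (lam : MvPolynomial (Fin N ⊕ Fin N) ℝ) (α : ℝ)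
    (P : (Fin N → ℝ) → Matrix (Fin n) (Fin n) ℝ) : Prop :=
  ∀ ρ ∈ S, (P ρ).PosDef ∧
    (∀ i j, IntegrableOn (fun θ => evalRate lam ρ θ * (P θ i j - P ρ i j)) S) ∧
    (-(He (P ρ * evalMat A ρ) + jumpIntegral S lam P ρ + (2 * α) • P ρ)).PosSemidef

/-- `F` is a sum of squares matrix: `F(ρ) = L(ρ)ᵀ L(ρ)` on `ℝ^N` for some (possibly rectangular)
polynomial matrix `L`. -/
def IsSOS {N n : ℕ} (F : (Fin N → ℝ) → Matrix (Fin n) (Fin n) ℝ) : Prop :=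
  ∃ (k : ℕ) (L : Matrix (Fin k) (Fin n) (MvPolynomial (Fin N) ℝ)),
    ∀ ρ, F ρ = (evalMat L ρ)ᵀ * evalMat L ρ

/-- `(P, Γ₁, Γ₂)` is a feasible point of the sum of squares program. -/
structure SOSFeasible {N n M : ℕ} (g : Fin M → MvPolynomial (Fin N) ℝ)
    (A : Matrix (Fin n) (Fin n) (MvPolynomial (Fin N) ℝ))
    (lam : MvPolynomial (Fin N ⊕ Fin N) ℝ) (ε α : ℝ)
    (P : Matrix (Fin n) (Fin n) (MvPolynomial (Fin N) ℝ))
    (Γ₁ Γ₂ : Fin M → Matrix (Fin n) (Fin n) (MvPolynomial (Fin N) ℝ)) : Prop where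
  symm : P.IsSymm
  c1 : ∀ i, IsSOS (evalMat (Γ₁ i)) ∧ IsSOS (evalMat (Γ₂ i))
  c2 : IsSOS fun ρ => evalMat P ρ - ∑ i, MvPolynomial.eval ρ (g i) • evalMat (Γ₁ i) ρ
    - ε • (1 : Matrix (Fin n) (Fin n) ℝ)
  c3 : IsSOS fun ρ => -He (evalMat P ρ * evalMat A ρ)
    - jumpIntegral (semialgebraicSet g) lam (evalMat P) ρ
    - ∑ i, MvPolynomial.eval ρ (g i) • evalMat (Γ₂ i) ρ - (2 * α) • evalMat P ρ

end LPVJump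

/-! On the compact set each `g i` is nonnegative, so adding back the terms `g i • Γ i` to the SOS
matrices of (C2) and (C3) gives P ≥ εI and the matrix inequality.

For stability, let V(x, ρ) = ⟨x, P(ρ)x⟩. The matrix inequality says that the generator of (x, ρ)
maps V below -2αV. Dynkin's formula is replaced by a time discretisation. On a grid of step δ the
state follows the explicit Euler scheme, so its value at kδ depends only on the parameter before kδ,
and the Markov property of ρ alone gives E V(step k+1) ≤ exp(-2αδ + Dδ²) E V(step k)
(`integral_lyapunov_step_le`). Over [0, t] the errors add up to Dtδ, which vanishes. Almost every
path of ρ is piecewise constant, so the scheme converges pathwise (`tendsto_euler`); it is bounded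
by a deterministic constant, and dominated convergence concludes.

The crux is that D is uniform, while the jump rates are only given as o(h) for each fixed ρ and B.
Chapman-Kolmogorov upgrades this to a uniform second-order expansion
(`abs_integral_sub_generator_le`). -/

namespace LPVJump

/-! ### Transition semigroup of a jump process with bounded rates. -/

section Semigroup

/-- Finite measures that converge on every measurable set converge against bounded measurable
functions. -/
lemma tendsto_integral_of_tendsto_measureReal {E : Type*} [MeasurableSpace E] {ι : Type*}
    {l : Filter ι} [l.IsCountablyGenerated] {m : ι → Measure E} {κ : Measure E}
    [∀ i, IsFiniteMeasure (m i)] [IsFiniteMeasure κ]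
    (h : ∀ B, MeasurableSet B → Tendsto (fun i => (m i).real B) l (𝓝 (κ.real B)))
    {f : E → ℝ} (hf : Measurable f) {c : ℝ} (hc : ∀ x, |f x| ≤ c) :
    Tendsto (fun i => ∫ x, f x ∂(m i)) l (𝓝 (∫ x, f x ∂κ)) := by
  have hint : ∀ (ν : Measure E) [IsFiniteMeasure ν], Integrable f ν := fun ν _ =>
    Integrable.of_bound hf.aestronglyMeasurable c (Eventually.of_forall hc)
  have key : ∀ (ν : Measure E) [IsFiniteMeasure ν],
      -- Layer cake for f + c, whose values lie in [0, 2c]. This reduces the claim to dominated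
      -- convergence in t on a bounded interval.
      ∫ x, f x ∂ν = (∫ t in Set.Ioc 0 (2 * c), ν.real {x | t ≤ f x + c}) - ν.real Set.univ * c := by
    intro ν _
    have h1 : Integrable (fun x => f x + c) ν := (hint ν).add (integrable_const c)
    rw [← h1.integral_eq_integral_Ioc_meas_le (M := 2 * c), integral_add (hint ν)
      (integrable_const c)]
    · simp
    · exact Eventually.of_forall fun x => by
        have := (abs_le.1 (hc x)).1
        simp only [Pi.zero_apply]; linarith
    · exact Eventually.of_forall fun x => by
        have := (abs_le.1 (hc x)).2
        simp only; linarith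
  simp only [key]
  refine Tendsto.sub ?_ ((h _ MeasurableSet.univ).mul_const c)
  refine tendsto_integral_filter_of_dominated_convergence (fun _ => κ.real Set.univ + 1) ?_ ?_ ?_ ?_
  · refine Eventually.of_forall fun i => ?_
    have : Antitone fun t => (m i).real {x | t ≤ f x + c} := fun s t hst =>
      measureReal_mono fun x (hx : t ≤ f x + c) => hst.trans hx
    exact this.measurable.aestronglyMeasurable
  · have := (h _ MeasurableSet.univ).eventually (eventually_le_nhds (lt_add_one _))
    filter_upwards [this] with i hi
    refine Eventually.of_forall fun t => ?_
    rw [Real.norm_of_nonneg measureReal_nonneg]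
    exact (measureReal_mono (Set.subset_univ _)).trans hi
  · exact integrable_const _
  · exact Eventually.of_forall fun t => h _ (measurableSet_le measurable_const (hf.add_const c))

variable {E : Type*} [MeasurableSpace E] {p : ℝ → Kernel E E}
  {κ : E → Measure E} [∀ ρ, IsFiniteMeasure (κ ρ)]

/-- The generator `f ↦ ∫ (f(θ) - f(ρ)) κ(ρ, dθ)` of a jump process. -/
noncomputable def generator (κ : E → Measure E) (f : E → ℝ) (ρ : E) : ℝ :=
  ∫ θ, (f θ - f ρ) ∂(κ ρ)

lemma abs_integral_le_of_abs_le {ν : Measure E} [IsProbabilityMeasure ν] {f : E → ℝ} {c : ℝ}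
    (hc : ∀ x, |f x| ≤ c) : |∫ x, f x ∂ν| ≤ c := by
  simpa using norm_integral_le_of_norm_le_const (μ := ν) (f := f) (C := c) (Eventually.of_forall hc)

lemma abs_generator_le {C : ℝ} (hC : ∀ ρ, (κ ρ).real Set.univ ≤ C) {f : E → ℝ} {c : ℝ}
    (hc : ∀ x, |f x| ≤ c) (ρ : E) : |generator κ f ρ| ≤ 2 * c * C := by
  have hc0 : 0 ≤ c := (abs_nonneg _).trans (hc ρ)
  have := norm_integral_le_of_norm_le_const (μ := κ ρ) (f := fun θ => f θ - f ρ) (C := 2 * c)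
    (Eventually.of_forall fun θ => by
      have h1 := abs_le.1 (hc θ)
      have h2 := abs_le.1 (hc ρ)
      rw [Real.norm_eq_abs, abs_le]
      constructor <;> linarith)
  exact this.trans (mul_le_mul_of_nonneg_left (hC ρ) (by positivity))

/-- Infinitesimal description of the transition function at `0+`. -/
lemma tendsto_slope_integral [MeasurableSingletonClass E]
    (hp : ∀ t, 0 ≤ t → IsMarkovKernel (p t))
    (hrate : ∀ (ρ : E) (B : Set E), MeasurableSet B → ρ ∉ B →
      (fun h : ℝ => (p h ρ).real B - (κ ρ).real B * h) =o[𝓝[>] (0 : ℝ)] (fun h : ℝ => h))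
    {f : E → ℝ} (hf : Measurable f) {c : ℝ} (hc : ∀ x, |f x| ≤ c) (ρ : E) :
    Tendsto (fun h => h⁻¹ * (∫ θ, f θ ∂(p h ρ) - f ρ)) (𝓝[>] 0) (𝓝 (generator κ f ρ)) := by
  have hg : Measurable fun θ => f θ - f ρ := hf.sub_const _
  have hgc : ∀ θ, |f θ - f ρ| ≤ 2 * c := fun θ => by
    have h1 := abs_le.1 (hc θ)
    have h2 := abs_le.1 (hc ρ)
    rw [abs_le]
    constructor <;> linarith
  have hprob : ∀ h : Set.Ioi (0 : ℝ), IsProbabilityMeasure (p h ρ) := fun h =>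
    (hp h (le_of_lt h.2)).isProbabilityMeasure ρ
  -- The integrand vanishes at ρ, so the mass at ρ, about which `hrate` says nothing, can be
  -- removed.
  have hlim : ∀ ν : Measure E, ∫ θ, (f θ - f ρ) ∂ν = ∫ θ, (f θ - f ρ) ∂(ν.restrict {ρ}ᶜ) := by
    intro ν
    rw [setIntegral_eq_integral_of_forall_compl_eq_zero]
    intro x hx
    have : x = ρ := by simpa using hx
    simp [this]
  -- The limit moves to the subtype of positive times, where every `p h ρ` is a finite measure.
  rw [← map_coe_Ioi_atBot, tendsto_map'_iff]
  have main := tendsto_integral_of_tendsto_measureReal (l := (atBot : Filter (Set.Ioi (0 : ℝ))))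
    (m := fun h : Set.Ioi (0 : ℝ) => (Real.toNNReal (h : ℝ)⁻¹) • ((p h ρ).restrict {ρ}ᶜ))
    (κ := (κ ρ).restrict {ρ}ᶜ) (f := fun θ => f θ - f ρ) ?_ hg hgc
  · unfold generator
    rw [hlim]
    refine main.congr fun h => ?_
    have h0 : 0 ≤ (h : ℝ)⁻¹ := inv_nonneg.2 (le_of_lt h.2)
    rw [integral_smul_nnreal_measure, ← hlim, integral_sub _ (integrable_const _)]
    · simp [NNReal.smul_def, h0]
    · exact Integrable.of_bound hf.aestronglyMeasurable c (Eventually.of_forall hc)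
  · intro B hB
    have h1 := hrate ρ (B ∩ {ρ}ᶜ) (hB.inter (measurableSet_singleton ρ).compl) (by simp)
    rw [← map_coe_Ioi_atBot, Asymptotics.isLittleO_map] at h1
    have h2 := h1.tendsto_div_nhds_zero
    rw [measureReal_restrict_apply hB]
    have h3 := h2.add_const ((κ ρ).real (B ∩ {ρ}ᶜ))
    rw [zero_add] at h3
    refine h3.congr fun h => ?_
    have h0 : (0 : ℝ) < h := h.2
    have : 0 ≤ (h : ℝ)⁻¹ := inv_nonneg.2 h0.le
    simp only [Function.comp_apply]
    rw [measureReal_nnreal_smul_apply, measureReal_restrict_apply hB, Real.coe_toNNReal _ this]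
    field_simp
    ring

/-- Second order expansion of the semigroup at time `0`, uniform in the starting point. -/
lemma abs_integral_sub_generator_le [MeasurableSingletonClass E]
    (hp : ∀ t, 0 ≤ t → IsMarkovKernel (p t))
    (hp0 : p 0 = Kernel.id)
    (hck : ∀ s t, 0 ≤ s → 0 ≤ t → p (s + t) = p t ∘ₖ p s)
    (hrate : ∀ (ρ : E) (B : Set E), MeasurableSet B → ρ ∉ B →
      (fun h : ℝ => (p h ρ).real B - (κ ρ).real B * h) =o[𝓝[>] (0 : ℝ)] (fun h : ℝ => h))
    {C : ℝ} (hC : ∀ ρ, (κ ρ).real Set.univ ≤ C)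
    {f : E → ℝ} (hf : Measurable f) {c : ℝ} (hc : ∀ x, |f x| ≤ c) (ρ : E) {h : ℝ} (hh : 0 ≤ h) :
    |∫ θ, f θ ∂(p h ρ) - f ρ - h * generator κ f ρ| ≤ 4 * c * C ^ 2 * h ^ 2 := by
  have hc0 : 0 ≤ c := (abs_nonneg _).trans (hc ρ)
  have hC0 : 0 ≤ C := measureReal_nonneg.trans (hC ρ)
  set u : ℝ → E → ℝ := fun t ρ => ∫ θ, f θ ∂(p t ρ) with hu
  have hum : ∀ t, 0 ≤ t → Measurable (u t) := fun t ht => by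
    have := hp t ht
    exact hf.stronglyMeasurable.integral_kernel.measurable
  have huc : ∀ t, 0 ≤ t → ∀ ρ, |u t ρ| ≤ c := fun t ht ρ => by
    have := (hp t ht).isProbabilityMeasure ρ
    exact abs_integral_le_of_abs_le hc
  have hu0 : ∀ ρ, u 0 ρ = f ρ := fun ρ => by
    simp only [hu, hp0, Kernel.id_apply, integral_dirac]
  have hadd : ∀ s t, 0 ≤ s → 0 ≤ t → ∀ ρ, u (s + t) ρ = ∫ θ, u t θ ∂(p s ρ) := by
    intro s t hs ht ρ
    have := hp s hs
    have := hp t ht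
    simp only [hu, hck s t hs ht]
    exact Kernel.integral_comp
      (Integrable.of_bound hf.aestronglyMeasurable c (Eventually.of_forall hc))
  -- Backward equation: u(s) is p(s - t) applied to u(t), so the slope at t is the slope at 0 with
  -- u(t) in place of f.
  have hderiv : ∀ ρ t, 0 ≤ t →
      HasDerivWithinAt (fun s => u s ρ) (generator κ (u t) ρ) (Set.Ici t) t := by
    intro ρ t ht
    rw [hasDerivWithinAt_iff_tendsto_slope, Set.Ici_sdiff_left]
    have h1 := tendsto_slope_integral hp hrate (hum t ht) (huc t ht) ρ
    have h2 : Tendsto (fun s => s - t) (𝓝[>] t) (𝓝[>] 0) := by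
      refine tendsto_nhdsWithin_iff.2 ⟨?_, ?_⟩
      · have : Tendsto (fun s => s - t) (𝓝 t) (𝓝 (t - t)) := tendsto_id.sub_const t
        rw [sub_self] at this
        exact this.mono_left nhdsWithin_le_nhds
      · filter_upwards [self_mem_nhdsWithin] with s hs
        exact sub_pos.2 (Set.mem_Ioi.1 hs)
    refine (h1.comp h2).congr' ?_
    filter_upwards [self_mem_nhdsWithin] with s hs
    have hs' : t < s := hs
    simp only [Function.comp_apply, slope, vsub_eq_sub, smul_eq_mul]
    rw [← hadd (s - t) t (by linarith) ht, sub_add_cancel]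
  -- The right derivative gives only right continuity. From the left, the increment is at most 2c
  -- times the probability of having left ρ after time t - s.
  have hcont : ∀ ρ, ContinuousOn (fun s => u s ρ) (Set.Ici 0) := by
    intro ρ
    have hω := tendsto_slope_integral hp hrate (f := Set.indicator {ρ}ᶜ 1) (c := 1)
      (measurable_one.indicator (measurableSet_singleton ρ).compl)
      (fun x => by by_cases hx : x = ρ <;> simp [hx]) ρ
    have hω' : Tendsto (fun s => (p s ρ).real {ρ}ᶜ) (𝓝[>] 0) (𝓝 0) := by
      have h2 : Tendsto (fun s : ℝ => s) (𝓝[>] 0) (𝓝 0) := tendsto_id.mono_left nhdsWithin_le_nhds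
      have h3 := h2.mul hω
      rw [zero_mul] at h3
      refine h3.congr' ?_
      filter_upwards [self_mem_nhdsWithin] with s hs
      have hs' : (0 : ℝ) < s := hs
      rw [integral_indicator_one (measurableSet_singleton ρ).compl]
      simp only [Set.mem_compl_iff, Set.mem_singleton_iff, not_true_eq_false, not_false_eq_true,
        Set.indicator_of_notMem, sub_zero]
      field_simp
    have hbd : ∀ s t, 0 ≤ s → s ≤ t → |u t ρ - u s ρ| ≤ 2 * c * (p (t - s) ρ).real {ρ}ᶜ := by
      intro s t hs hst
      have := (hp (t - s) (sub_nonneg.2 hst)).isProbabilityMeasure ρ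
      have h1 : u t ρ - u s ρ = ∫ θ in {ρ}ᶜ, (u s θ - u s ρ) ∂(p (t - s) ρ) := by
        rw [setIntegral_eq_integral_of_forall_compl_eq_zero]
        · rw [integral_sub _ (integrable_const _), ← hadd _ _ (sub_nonneg.2 hst) hs]
          · simp
          · exact Integrable.of_bound (hum s hs).aestronglyMeasurable c
              (Eventually.of_forall (huc s hs))
        · intro x hx
          have : x = ρ := by simpa using hx
          simp [this]
      rw [h1, ← Real.norm_eq_abs]
      refine norm_setIntegral_le_of_norm_le_const (measure_lt_top _ _) fun θ _ => ?_
      have h1 := abs_le.1 (huc s hs θ)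
      have h2 := abs_le.1 (huc s hs ρ)
      rw [Real.norm_eq_abs, abs_le]
      constructor <;> linarith
    intro t ht
    have ht' : (0 : ℝ) ≤ t := ht
    have hgt : ContinuousWithinAt (fun s => u s ρ) (Set.Ici t) t :=
      (hderiv ρ t ht).continuousWithinAt
    have hlt : Tendsto (fun s => u s ρ) (𝓝[Set.Ico 0 t] t) (𝓝 (u t ρ)) := by
      rw [tendsto_iff_norm_sub_tendsto_zero]
      have h2 : Tendsto (fun s => t - s) (𝓝[Set.Ico 0 t] t) (𝓝[>] 0) := by
        refine tendsto_nhdsWithin_iff.2 ⟨?_, ?_⟩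
        · have : Tendsto (fun s => t - s) (𝓝 t) (𝓝 (t - t)) := tendsto_id.const_sub t
          rw [sub_self] at this
          exact this.mono_left nhdsWithin_le_nhds
        · filter_upwards [self_mem_nhdsWithin] with s hs
          exact sub_pos.2 hs.2
      have h3 := (hω'.comp h2).const_mul (2 * c)
      rw [mul_zero] at h3
      refine squeeze_zero' (Eventually.of_forall fun _ => norm_nonneg _) ?_ h3
      filter_upwards [self_mem_nhdsWithin] with s hs
      rw [norm_sub_rev]
      exact hbd s t hs.1 hs.2.le
    have : Set.Ici (0 : ℝ) = Set.Ico 0 t ∪ Set.Ici t := (Set.Ico_union_Ici_eq_Ici ht').symm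
    rw [this]
    exact ContinuousWithinAt.union hlt hgt
  have hlip : ∀ ρ t, 0 ≤ t → |u t ρ - f ρ| ≤ 2 * c * C * t := by
    intro ρ t ht
    have := norm_image_sub_le_of_norm_deriv_right_le_segment (f := fun s => u s ρ)
      (f' := fun s => generator κ (u s) ρ) (a := 0) (b := t) (C := 2 * c * C)
      ((hcont ρ).mono Set.Icc_subset_Ici_self) (fun x hx => hderiv ρ x hx.1)
      (fun x hx => abs_generator_le hC (huc x hx.1) ρ) t ⟨ht, le_rfl⟩
    simpa [hu0] using this
  have hint : ∀ t, 0 ≤ t → Integrable (fun θ => u t θ - u t ρ) (κ ρ) := fun t ht =>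
    (Integrable.of_bound (hum t ht).aestronglyMeasurable c
      (Eventually.of_forall (huc t ht))).sub (integrable_const _)
  have hfu : f = u 0 := funext fun ρ => (hu0 ρ).symm
  -- Second use of the mean value inequality: the right derivative is the generator applied to u(s)
  -- - f, which `hlip` bounds by 2cCh uniformly in space; hence 2 · 2cCh · C.
  have := norm_image_sub_le_of_norm_deriv_right_le_segment
    (f := fun s => u s ρ - s * generator κ f ρ)
    (f' := fun s => generator κ (u s) ρ - generator κ f ρ) (a := 0) (b := h)
    (C := 4 * c * C ^ 2 * h)
    (((hcont ρ).mono Set.Icc_subset_Ici_self).sub (by fun_prop))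
    (fun x hx => (hderiv ρ x hx.1).sub (by
      simpa using (hasDerivWithinAt_id x (Set.Ici x)).mul_const (generator κ f ρ)))
    (fun x hx => by
      have e : generator κ (u x) ρ - generator κ f ρ = generator κ (fun θ => u x θ - f θ) ρ := by
        unfold generator
        rw [hfu, ← integral_sub (hint x hx.1) (hint 0 le_rfl)]
        congr 1
        funext θ
        ring
      rw [e]
      have hle : 2 * c * C * x ≤ 2 * c * C * h :=
        mul_le_mul_of_nonneg_left hx.2.le (by positivity)
      refine (abs_generator_le hC (fun θ => (hlip θ x hx.1).trans hle) ρ).trans (le_of_eq ?_)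
      ring) h ⟨hh, le_rfl⟩
  simp only [hu0, zero_mul, sub_zero, Real.norm_eq_abs] at this
  refine le_of_eq_of_le ?_ (this.trans (le_of_eq (by ring)))
  congr 1
  simp only [hu]
  ring

end Semigroup

/-! ### Pathwise convergence of the Euler scheme. -/

section Euler

variable {V : Type*} [NormedAddCommGroup V] [NormedSpace ℝ V]

/-- The explicit Euler scheme with step `δ` for `x' = B(t) x`. -/
noncomputable def euler (B : ℝ → V →L[ℝ] V) (x₀ : V) (δ : ℝ) : ℕ → V
  | 0 => x₀
  | k + 1 => euler B x₀ δ k + δ • B (k * δ) (euler B x₀ δ k)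

/-- Discrete Gronwall, from 1 + Kδ ≤ exp(Kδ). At kδ = t the bound no longer depends on the step, so
it serves as the dominating constant. -/
lemma norm_euler_le {B : ℝ → V →L[ℝ] V} {K : ℝ} (hK : ∀ t, 0 ≤ t → ‖B t‖ ≤ K) (x₀ : V) {δ : ℝ}
    (hδ : 0 ≤ δ) (k : ℕ) : ‖euler B x₀ δ k‖ ≤ Real.exp (K * (k * δ)) * ‖x₀‖ := by
  have hK0 : 0 ≤ K := (norm_nonneg _).trans (hK 0 le_rfl)
  induction k with
  | zero => simp [euler]
  | succ k ih =>
    have h1 : ‖B (k * δ) (euler B x₀ δ k)‖ ≤ K * ‖euler B x₀ δ k‖ :=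
      (B (k * δ)).le_of_opNorm_le (hK _ (by positivity)) _
    have h2 : 1 + K * δ ≤ Real.exp (K * δ) := by linarith [Real.add_one_le_exp (K * δ)]
    calc ‖euler B x₀ δ (k + 1)‖ ≤ ‖euler B x₀ δ k‖ + δ * (K * ‖euler B x₀ δ k‖) := by
          refine (norm_add_le _ _).trans ?_
          rw [norm_smul, Real.norm_of_nonneg hδ]
          gcongr
      _ = (1 + K * δ) * ‖euler B x₀ δ k‖ := by ring
      _ ≤ Real.exp (K * δ) * (Real.exp (K * (k * δ)) * ‖x₀‖) := by gcongr
      _ = _ := by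
          rw [← mul_assoc, ← Real.exp_add]
          push_cast
          ring_nf

lemma norm_flow_le {B : ℝ → V →L[ℝ] V} {K : ℝ} (hK : ∀ t, 0 ≤ t → ‖B t‖ ≤ K) {x : ℝ → V}
    (hx : ContinuousOn x (Set.Ici 0))
    (hx' : ∀ t, 0 ≤ t → HasDerivWithinAt x (B t (x t)) (Set.Ici t) t) {t : ℝ} (ht : 0 ≤ t) :
    ‖x t‖ ≤ Real.exp (K * t) * ‖x 0‖ := by
  have := norm_le_gronwallBound_of_norm_deriv_right_le (f := x) (f' := fun t => B t (x t))
    (δ := ‖x 0‖) (K := K) (ε := 0) (a := 0) (b := t) (hx.mono Set.Icc_subset_Ici_self)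
    (fun s hs => hx' s hs.1) le_rfl
    (fun s hs => by simpa using (B s).le_of_opNorm_le (hK s hs.1) _) t ⟨ht, le_rfl⟩
  rw [gronwallBound_ε0, sub_zero] at this
  linarith

/-- Local truncation error of the Euler scheme. -/
lemma norm_euler_step_le {B : ℝ → V →L[ℝ] V} {K : ℝ} (hK : ∀ t, 0 ≤ t → ‖B t‖ ≤ K) {x : ℝ → V}
    (hx : ContinuousOn x (Set.Ici 0))
    (hx' : ∀ t, 0 ≤ t → HasDerivWithinAt x (B t (x t)) (Set.Ici t) t) {X s δ : ℝ} (hs : 0 ≤ s)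
    (hδ : 0 ≤ δ) (hX : ∀ r ∈ Set.Icc s (s + δ), ‖x r‖ ≤ X) :
    ‖x (s + δ) - x s - δ • B s (x s)‖ ≤ 2 * K * X * δ ∧
    ((∀ r ∈ Set.Ico s (s + δ), B r = B s) →
      ‖x (s + δ) - x s - δ • B s (x s)‖ ≤ K ^ 2 * X * δ ^ 2) := by
  have hK0 : 0 ≤ K := (norm_nonneg _).trans (hK 0 le_rfl)
  have hsub : Set.Icc s (s + δ) ⊆ Set.Ici 0 := fun r hr => hs.trans hr.1
  have hend : s + δ ∈ Set.Icc s (s + δ) := ⟨by linarith, le_rfl⟩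
  have hX0 : 0 ≤ X := (norm_nonneg _).trans (hX _ hend)
  have hB : ∀ r ∈ Set.Icc s (s + δ), ∀ q, 0 ≤ q → ‖B q (x r)‖ ≤ K * X := fun r hr q hq =>
    ((B q).le_of_opNorm_le (hK q hq) _).trans (mul_le_mul_of_nonneg_left (hX r hr) hK0)
  have hs' : s ∈ Set.Icc s (s + δ) := ⟨le_rfl, by linarith⟩
  have hlip : ∀ r ∈ Set.Icc s (s + δ), ‖x r - x s‖ ≤ K * X * (r - s) :=
    norm_image_sub_le_of_norm_deriv_right_le_segment (f' := fun t => B t (x t))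
      (hx.mono hsub) (fun r hr => hx' r (hs.trans hr.1))
      (fun r hr => hB r (Set.Ico_subset_Icc_self hr) r (hs.trans hr.1))
  -- Mean value inequality for x minus its tangent line at s.
  have key : ∀ D : ℝ, (∀ r ∈ Set.Ico s (s + δ), ‖B r (x r) - B s (x s)‖ ≤ D) →
      ‖x (s + δ) - x s - δ • B s (x s)‖ ≤ D * δ := by
    intro D hD
    have := norm_image_sub_le_of_norm_deriv_right_le_segment
      (f := fun r => x r - (r - s) • B s (x s)) (f' := fun r => B r (x r) - B s (x s))
      (a := s) (b := s + δ) (C := D) ((hx.mono hsub).sub (by fun_prop))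
      (fun r hr => (hx' r (hs.trans hr.1)).sub (by
        simpa using ((hasDerivWithinAt_id r (Set.Ici r)).sub_const s).smul_const (B s (x s))))
      hD (s + δ) hend
    simp only [add_sub_cancel_left, sub_self, zero_smul, sub_zero] at this
    rwa [sub_right_comm] at this
  refine ⟨key _ fun r hr => ?_, fun hconst => ?_⟩
  · refine (norm_sub_le _ _).trans ?_
    linarith [hB r (Set.Ico_subset_Icc_self hr) r (hs.trans hr.1), hB s hs' s hs]
  · refine (key (K * (K * X * δ)) fun r hr => ?_).trans (le_of_eq (by ring))
    rw [hconst r hr, ← map_sub]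
    refine ((B s).le_of_opNorm_le (hK s hs) _).trans (mul_le_mul_of_nonneg_left ?_ hK0)
    refine (hlip r (Set.Ico_subset_Icc_self hr)).trans
      (mul_le_mul_of_nonneg_left ?_ (by positivity))
    linarith [hr.2]

/-- Error propagation for the Euler scheme. -/
lemma norm_sub_euler_le {B : ℝ → V →L[ℝ] V} {K : ℝ} (hK : ∀ t, 0 ≤ t → ‖B t‖ ≤ K) (x : ℝ → V)
    {δ : ℝ} (hδ : 0 ≤ δ) (k : ℕ) :
    ‖x (k * δ) - euler B (x 0) δ k‖ ≤ Real.exp (K * (k * δ)) *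
      ∑ i ∈ Finset.range k, ‖x (i * δ + δ) - x (i * δ) - δ • B (i * δ) (x (i * δ))‖ := by
  have hK0 : 0 ≤ K := (norm_nonneg _).trans (hK 0 le_rfl)
  induction k with
  | zero => simp [euler]
  | succ k ih =>
    set e := x (k * δ) - euler B (x 0) δ k with he
    set R := ∑ i ∈ Finset.range k, ‖x (i * δ + δ) - x (i * δ) - δ • B (i * δ) (x (i * δ))‖
    set r := x (k * δ + δ) - x (k * δ) - δ • B (k * δ) (x (k * δ)) with hr
    have hcast : ((k + 1 : ℕ) : ℝ) * δ = k * δ + δ := by push_cast; ring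
    have h1 : x ((k + 1 : ℕ) * δ) - euler B (x 0) δ (k + 1) = e + δ • B (k * δ) e + r := by
      rw [hcast, he, hr, map_sub, smul_sub, euler]
      abel
    have h2 : 1 + K * δ ≤ Real.exp (K * δ) := by linarith [Real.add_one_le_exp (K * δ)]
    have h3 : ‖B (k * δ) e‖ ≤ K * ‖e‖ := (B (k * δ)).le_of_opNorm_le (hK _ (by positivity)) _
    have h4 : (1 : ℝ) ≤ Real.exp (K * (k * δ + δ)) := Real.one_le_exp (by positivity)
    rw [h1, hcast, Finset.sum_range_succ]
    calc ‖e + δ • B (k * δ) e + r‖ ≤ ‖e‖ + δ * (K * ‖e‖) + ‖r‖ := by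
          refine (norm_add_le _ _).trans (add_le_add_left ((norm_add_le _ _).trans ?_) _)
          rw [norm_smul, Real.norm_of_nonneg hδ]
          gcongr
      _ = (1 + K * δ) * ‖e‖ + ‖r‖ := by ring
      _ ≤ Real.exp (K * δ) * (Real.exp (K * (k * δ)) * R) +
          Real.exp (K * (k * δ + δ)) * ‖r‖ := by
          gcongr
          exact le_mul_of_one_le_left (norm_nonneg _) h4
      _ = Real.exp (K * (k * δ + δ)) * (R + ‖r‖) := by
          rw [mul_add K, Real.exp_add]
          ring

/-- The Euler scheme converges for piecewise constant coefficients. -/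
lemma tendsto_euler {E : Type*} {B : E → V →L[ℝ] V} {K : ℝ} (hK : ∀ ρ, ‖B ρ‖ ≤ K) {r : ℝ → E}
    (hr : IsPiecewiseConstant r) {x : ℝ → V} (hx : ContinuousOn x (Set.Ici 0))
    (hx' : ∀ t, 0 ≤ t → HasDerivWithinAt x (B (r t) (x t)) (Set.Ici t) t) {t : ℝ} (ht : 0 ≤ t) :
    Tendsto (fun m : ℕ => euler (fun s => B (r s)) (x 0) (t / (m + 1 : ℕ)) (m + 1)) atTop
      (𝓝 (x t)) := by
  classical
  obtain ⟨τ, hτ0, hτm, hτt, hτ⟩ := hr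
  have hK0 : 0 ≤ K := (norm_nonneg _).trans (hK (r 0))
  have hK' : ∀ t, 0 ≤ t → ‖B (r t)‖ ≤ K := fun t _ => hK _
  obtain ⟨J, hJ⟩ := (hτt.eventually_ge_atTop t).exists
  set X := Real.exp (K * t) * ‖x 0‖ with hXdef
  have hX0 : 0 ≤ X := by positivity
  have hX : ∀ s, 0 ≤ s → s ≤ t → ‖x s‖ ≤ X := fun s h0 hs =>
    (norm_flow_le hK' hx hx' h0).trans
      (mul_le_mul_of_nonneg_right (Real.exp_le_exp.2 (mul_le_mul_of_nonneg_left hs hK0))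
        (norm_nonneg _))
  have main : ∀ m : ℕ, ‖x t - euler (fun s => B (r s)) (x 0) (t / (m + 1 : ℕ)) (m + 1)‖ ≤
      Real.exp (K * t) * (K ^ 2 * X * t + J * (2 * K * X)) * (t / (m + 1 : ℕ)) := by
    intro m
    set δ := t / (m + 1 : ℕ) with hδ
    have hδ0 : 0 ≤ δ := by positivity
    have hmδ : ((m + 1 : ℕ) : ℝ) * δ = t := by rw [hδ]; field_simp
    have h1 := norm_sub_euler_le hK' x hδ0 (m + 1)
    rw [hmδ] at h1
    refine h1.trans ?_
    rw [mul_assoc]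
    refine mul_le_mul_of_nonneg_left ?_ (Real.exp_pos _).le
    -- Indices of the steps that contain a breakpoint. There are at most J, however small δ is; each
    -- costs O(δ), the others O(δ²).
    set bad := (Finset.range J).image fun j => ⌊τ j / δ⌋₊ with hbad
    have hstep : ∀ i ∈ Finset.range (m + 1),
        ‖x (i * δ + δ) - x (i * δ) - δ • B (r (i * δ)) (x (i * δ))‖ ≤
          K ^ 2 * X * δ ^ 2 + if i ∈ bad then 2 * K * X * δ else 0 := by
      intro i hi
      have hi' : (i : ℝ) + 1 ≤ (m + 1 : ℕ) := by exact_mod_cast Finset.mem_range.1 hi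
      have hiδ : (i : ℝ) * δ + δ ≤ t := by
        rw [← hmδ]
        nlinarith
      have hi0 : 0 ≤ (i : ℝ) * δ := by positivity
      obtain ⟨ha, hb⟩ := norm_euler_step_le (B := fun s => B (r s)) hK' hx hx' hi0 hδ0
        (fun s hs => hX s (hi0.trans hs.1) (hs.2.trans hiδ))
      split_ifs with hmem
      · exact ha.trans (le_add_of_nonneg_left (by positivity))
      rw [add_zero]
      rcases hδ0.eq_or_lt with hz | hpos
      · simp [← hz]
      apply hb
      -- The first breakpoint after iδ: if it fell inside the step, i would be in `bad`.
      have hex : ∃ j, (i : ℝ) * δ < τ j := (hτt.eventually_gt_atTop _).exists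
      set j := Nat.find hex with hj
      have hjs : (i : ℝ) * δ < τ j := Nat.find_spec hex
      have hjpos : j ≠ 0 := fun h0 => by
        rw [h0, hτ0] at hjs
        linarith
      obtain ⟨k, hk⟩ := Nat.exists_eq_succ_of_ne_zero hjpos
      have hkle : τ k ≤ i * δ := not_lt.1 (Nat.find_min hex (by omega))
      have hge : (i : ℝ) * δ + δ ≤ τ j := by
        by_contra! hlt
        refine hmem (Finset.mem_image.2 ⟨j, Finset.mem_range.2 ?_, ?_⟩)
        · by_contra! hJj
          linarith [hτm hJj]
        · rw [Nat.floor_eq_iff (div_nonneg (hi0.trans hjs.le) hδ0)]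
          constructor
          · rw [le_div_iff₀ hpos]; exact hjs.le
          · rw [div_lt_iff₀ hpos]; linarith
      have hc : ∀ s ∈ Set.Ico ((i : ℝ) * δ) (i * δ + δ), r s = r (τ k) := fun s hs =>
        hτ k s ⟨hkle.trans hs.1, hs.2.trans_le (by rw [hk] at hge; exact hge)⟩
      intro s hs
      simp only [hc s hs, hc (i * δ) ⟨le_rfl, by linarith⟩]
    refine (Finset.sum_le_sum hstep).trans ?_
    rw [Finset.sum_add_distrib, Finset.sum_const, Finset.card_range, ← Finset.sum_filter,
      Finset.sum_const, nsmul_eq_mul, nsmul_eq_mul]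
    have hcard : (((Finset.range (m + 1)).filter (· ∈ bad)).card : ℝ) ≤ J := by
      have : ((Finset.range (m + 1)).filter (· ∈ bad)).card ≤ J :=
        (Finset.card_le_card fun i hi => (Finset.mem_filter.1 hi).2).trans
          (Finset.card_image_le.trans (by simp))
      exact_mod_cast this
    calc _ ≤ ((m + 1 : ℕ) : ℝ) * (K ^ 2 * X * δ ^ 2) + J * (2 * K * X * δ) := by gcongr
      _ = K ^ 2 * X * (((m + 1 : ℕ) : ℝ) * δ) * δ + J * (2 * K * X * δ) := by ring
      _ = _ := by rw [hmδ]; ring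
  rw [tendsto_iff_norm_sub_tendsto_zero]
  have hlim : Tendsto (fun m : ℕ => t / ((m + 1 : ℕ) : ℝ)) atTop (𝓝 0) :=
    (tendsto_const_div_atTop_nhds_zero_nat t).comp (tendsto_add_atTop_nat 1)
  have hlim' := hlim.const_mul (Real.exp (K * t) * (K ^ 2 * X * t + J * (2 * K * X)))
  rw [mul_zero] at hlim'
  refine squeeze_zero (fun _ => norm_nonneg _) (fun m => ?_) hlim'
  rw [norm_sub_rev]
  exact main m

end Euler

/-! ### Averaging over one transition of the parameter. -/

section MarkovStep

/-- The joint law of a past-measurable pair and a variable whose conditional law given the past is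
the kernel `q` evaluated at the second component. -/
lemma map_eq_compProd_of_condExp {Ω V E : Type*} {m𝓕 mΩ : MeasurableSpace Ω} [MeasurableSpace V]
    [MeasurableSpace E] {μ : Measure Ω} [IsProbabilityMeasure μ] (hle : m𝓕 ≤ mΩ) {Y : Ω → V}
    (hY : Measurable[m𝓕] Y) {R : Ω → E} (hR : Measurable[m𝓕] R) {R' : Ω → E} (hR' : Measurable R')
    {q : Kernel E E} [IsMarkovKernel q]
    (hq : ∀ B : Set E, MeasurableSet B →
      μ[(R' ⁻¹' B).indicator (fun _ => (1 : ℝ)) | m𝓕] =ᵐ[μ] fun ω => (q (R ω)).real B) :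
    μ.map (fun ω => ((Y ω, R ω), R' ω)) =
      (μ.map fun ω => (Y ω, R ω)) ⊗ₘ (q.comap Prod.snd measurable_snd) := by
  have hYR : Measurable[m𝓕] fun ω => (Y ω, R ω) := hY.prodMk hR
  have hYR' : Measurable fun ω => (Y ω, R ω) := hYR.mono hle le_rfl
  have hR0 : Measurable R := hR.mono hle le_rfl
  have := Measure.isProbabilityMeasure_map (μ := μ) hYR'.aemeasurable
  have := Measure.isProbabilityMeasure_map (μ := μ) (hYR'.prodMk hR').aemeasurable
  refine Measure.ext_prod fun {s B} hs hB => ?_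
  have hD : MeasurableSet[m𝓕] ((fun ω => (Y ω, R ω)) ⁻¹' s) := hYR hs
  have hBm : MeasurableSet (R' ⁻¹' B) := hR' hB
  have h1 := setIntegral_condExp (μ := μ) hle
    (f := (R' ⁻¹' B).indicator fun _ => (1 : ℝ)) ((integrable_const 1).indicator hBm) hD
  rw [setIntegral_congr_ae (hle _ hD) ((hq B hB).mono fun ω h _ => h)] at h1
  have hqm : Measurable fun ω => q (R ω) B := (q.measurable_coe hB).comp hR0
  rw [Measure.compProd_apply_prod hs hB, setLIntegral_map hs
      ((q.comap Prod.snd measurable_snd).measurable_coe hB) hYR',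
    Measure.map_apply (hYR'.prodMk hR') (hs.prod hB)]
  have e1 : (fun ω => ((Y ω, R ω), R' ω)) ⁻¹' (s ×ˢ B) =
      R' ⁻¹' B ∩ (fun ω => (Y ω, R ω)) ⁻¹' s := by
    ext ω
    simp [and_comm]
  rw [e1]
  simp only [Kernel.comap_apply]
  have e2 : ∫ ω in (fun ω => (Y ω, R ω)) ⁻¹' s, (q (R ω)).real B ∂μ =
      (∫⁻ ω in (fun ω => (Y ω, R ω)) ⁻¹' s, q (R ω) B ∂μ).toReal :=
    integral_toReal hqm.aemeasurable.restrict (Eventually.of_forall fun _ => measure_lt_top _ _)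
  have e3 : ∫ ω in (fun ω => (Y ω, R ω)) ⁻¹' s, (R' ⁻¹' B).indicator (fun _ => (1 : ℝ)) ω ∂μ =
      (μ (R' ⁻¹' B ∩ (fun ω => (Y ω, R ω)) ⁻¹' s)).toReal := by
    rw [integral_indicator_const _ hBm, smul_eq_mul, mul_one, measureReal_restrict_apply hBm]
    rfl
  rw [e2, e3] at h1
  refine ((ENNReal.toReal_eq_toReal_iff' ?_ (measure_ne_top _ _)).1 h1).symm
  refine ne_top_of_le_ne_top ENNReal.one_ne_top ?_
  calc ∫⁻ ω in (fun ω => (Y ω, R ω)) ⁻¹' s, q (R ω) B ∂μ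
      ≤ ∫⁻ ω, 1 ∂μ := (setLIntegral_le_lintegral _ _).trans (lintegral_mono fun ω => prob_le_one)
    _ = 1 := by simp

/-- Disintegrating the joint law integrates out R' first with (Y, R) frozen, so a bound on the
kernel integrals becomes a bound on expectations. -/
lemma integral_le_of_kernel_le {Ω V E : Type*} {m𝓕 mΩ : MeasurableSpace Ω} [MeasurableSpace V]
    [MeasurableSpace E] {μ : Measure Ω} [IsProbabilityMeasure μ] (hle : m𝓕 ≤ mΩ) {Y : Ω → V}
    (hY : Measurable[m𝓕] Y) {R : Ω → E} (hR : Measurable[m𝓕] R) {R' : Ω → E} (hR' : Measurable R')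
    {q : Kernel E E} [IsMarkovKernel q]
    (hq : ∀ B : Set E, MeasurableSet B →
      μ[(R' ⁻¹' B).indicator (fun _ => (1 : ℝ)) | m𝓕] =ᵐ[μ] fun ω => (q (R ω)).real B)
    {G : (V × E) × E → ℝ} (hG : Measurable G)
    (hGi : Integrable (fun ω => G ((Y ω, R ω), R' ω)) μ) {H : V × E → ℝ}
    (hHi : Integrable (fun ω => H (Y ω, R ω)) μ)
    (h : ∀ y ρ, ∫ θ, G ((y, ρ), θ) ∂(q ρ) ≤ H (y, ρ)) :
    ∫ ω, G ((Y ω, R ω), R' ω) ∂μ ≤ ∫ ω, H (Y ω, R ω) ∂μ := by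
  have hYR : Measurable fun ω => (Y ω, R ω) := (hY.mono hle le_rfl).prodMk (hR.mono hle le_rfl)
  have hYRR : Measurable fun ω => ((Y ω, R ω), R' ω) := hYR.prodMk hR'
  have hmap := map_eq_compProd_of_condExp hle hY hR hR' hq
  have hint : Integrable G (μ.map fun ω => ((Y ω, R ω), R' ω)) :=
    (integrable_map_measure hG.aestronglyMeasurable hYRR.aemeasurable).2 hGi
  have e1 : ∫ ω, G ((Y ω, R ω), R' ω) ∂μ = ∫ z, G z ∂(μ.map fun ω => ((Y ω, R ω), R' ω)) :=
    (integral_map hYRR.aemeasurable hG.aestronglyMeasurable).symm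
  have := Measure.isProbabilityMeasure_map (μ := μ) hYR.aemeasurable
  rw [hmap] at hint e1
  have hm : StronglyMeasurable fun a : V × E =>
      ∫ θ, G (a, θ) ∂((q.comap Prod.snd measurable_snd) a) :=
    hG.stronglyMeasurable.integral_kernel_prod_right'
  rw [e1, Measure.integral_compProd hint,
    integral_map hYR.aemeasurable hm.aestronglyMeasurable]
  refine integral_mono ?_ hHi fun ω => h (Y ω) (R ω)
  have hi := Integrable.integral_compProd (by rwa [Measure.compProd] at hint)
  exact (integrable_map_measure hm.aestronglyMeasurable hYR.aemeasurable).1 hi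

end MarkovStep

/-! ### One-step decrease of the Lyapunov function. -/

section Lyapunov

open scoped InnerProductSpace

variable {V : Type*} [NormedAddCommGroup V] [InnerProductSpace ℝ V]

lemma abs_inner_clm_le {T : V →L[ℝ] V} {c : ℝ} (hT : ‖T‖ ≤ c) (v w : V) :
    |⟪v, T w⟫_ℝ| ≤ c * ‖v‖ * ‖w‖ := by
  refine (abs_real_inner_le_norm _ _).trans ?_
  calc ‖v‖ * ‖T w‖ ≤ ‖v‖ * (c * ‖w‖) :=
        mul_le_mul_of_nonneg_left (T.le_of_opNorm_le hT w) (norm_nonneg _)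
    _ = _ := by ring

/-- One step of the Euler scheme, followed by a transition of the parameter, decreases a Lyapunov
function of the generator, up to an error of second order. -/
lemma integral_lyapunov_step_le {E : Type*} [MeasurableSpace E] [MeasurableSingletonClass E]
    {p : ℝ → Kernel E E} {κ : E → Measure E} [∀ ρ, IsFiniteMeasure (κ ρ)]
    (hp : ∀ t, 0 ≤ t → IsMarkovKernel (p t)) (hp0 : p 0 = Kernel.id)
    (hck : ∀ s t, 0 ≤ s → 0 ≤ t → p (s + t) = p t ∘ₖ p s)
    (hrate : ∀ (ρ : E) (B : Set E), MeasurableSet B → ρ ∉ B →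
      (fun h : ℝ => (p h ρ).real B - (κ ρ).real B * h) =o[𝓝[>] (0 : ℝ)] (fun h : ℝ => h))
    {C : ℝ} (hC : ∀ ρ, (κ ρ).real Set.univ ≤ C)
    {B P : E → V →L[ℝ] V} {K b ε α : ℝ} (hε : 0 < ε) (hK : ∀ ρ, ‖B ρ‖ ≤ K) (hb : ∀ ρ, ‖P ρ‖ ≤ b)
    (hPm : ∀ v, Measurable fun ρ => ⟪v, P ρ v⟫_ℝ) (hP : ∀ ρ v, ε * ‖v‖ ^ 2 ≤ ⟪v, P ρ v⟫_ℝ)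
    (hL : ∀ ρ v, ⟪B ρ v, P ρ v⟫_ℝ + ⟪v, P ρ (B ρ v)⟫_ℝ + generator κ (fun θ => ⟪v, P θ v⟫_ℝ) ρ
      + 2 * α * ⟪v, P ρ v⟫_ℝ ≤ 0)
    {T δ : ℝ} (hδ : 0 ≤ δ) (hT : δ ≤ T) (ρ : E) (y : V) :
    ∫ θ, ⟪y + δ • B ρ y, P θ (y + δ • B ρ y)⟫_ℝ ∂(p δ ρ) ≤
      Real.exp (-2 * α * δ + (b * K ^ 2 + 2 * (2 * K * b + T * K ^ 2 * b) * C
        + 4 * (b * (1 + T * K) ^ 2) * C ^ 2) / ε * δ ^ 2) * ⟪y, P ρ y⟫_ℝ := by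
  have hK0 : 0 ≤ K := (norm_nonneg _).trans (hK ρ)
  have hb0 : 0 ≤ b := (norm_nonneg _).trans (hb ρ)
  have hC0 : 0 ≤ C := measureReal_nonneg.trans (hC ρ)
  have hT0 : 0 ≤ T := hδ.trans hT
  set z := B ρ y with hz
  set w := y + δ • z with hw
  have hzn : ‖z‖ ≤ K * ‖y‖ := (B ρ).le_of_opNorm_le (hK ρ) y
  have hwn : ‖w‖ ≤ (1 + T * K) * ‖y‖ := by
    refine (norm_add_le _ _).trans ?_
    rw [norm_smul, Real.norm_of_nonneg hδ]
    have : δ * ‖z‖ ≤ T * (K * ‖y‖) := by gcongr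
    linarith
  have hexp : ∀ θ, ⟪w, P θ w⟫_ℝ = ⟪y, P θ y⟫_ℝ
      + δ * (⟪z, P θ y⟫_ℝ + ⟪y, P θ z⟫_ℝ) + δ ^ 2 * ⟪z, P θ z⟫_ℝ := by
    intro θ
    simp only [hw, map_add, map_smul, inner_add_left, inner_add_right, real_inner_smul_left,
      real_inner_smul_right]
    ring
  have hzy : ∀ θ, |⟪z, P θ y⟫_ℝ| ≤ K * b * ‖y‖ ^ 2 := fun θ =>
    (abs_inner_clm_le (hb θ) z y).trans (by
      calc b * ‖z‖ * ‖y‖ ≤ b * (K * ‖y‖) * ‖y‖ := by gcongr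
        _ = _ := by ring)
  have hyz : ∀ θ, |⟪y, P θ z⟫_ℝ| ≤ K * b * ‖y‖ ^ 2 := fun θ =>
    (abs_inner_clm_le (hb θ) y z).trans (by
      calc b * ‖y‖ * ‖z‖ ≤ b * ‖y‖ * (K * ‖y‖) := by gcongr
        _ = _ := by ring)
  have hzz : ∀ θ, |⟪z, P θ z⟫_ℝ| ≤ b * K ^ 2 * ‖y‖ ^ 2 := fun θ =>
    (abs_inner_clm_le (hb θ) z z).trans (by
      calc b * ‖z‖ * ‖z‖ ≤ b * (K * ‖y‖) * (K * ‖y‖) := by gcongr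
        _ = _ := by ring)
  have hbound : ∀ v θ, |⟪v, P θ v⟫_ℝ| ≤ b * ‖v‖ ^ 2 := fun v θ =>
    (abs_inner_clm_le (hb θ) v v).trans (le_of_eq (by ring))
  have hwb : ∀ θ, |⟪w, P θ w⟫_ℝ| ≤ b * (1 + T * K) ^ 2 * ‖y‖ ^ 2 := fun θ =>
    (hbound w θ).trans (by
      calc b * ‖w‖ ^ 2 ≤ b * ((1 + T * K) * ‖y‖) ^ 2 := by gcongr
        _ = _ := by ring)
  have hsemi := (abs_le.1 (abs_integral_sub_generator_le hp hp0 hck hrate hC (hPm w) hwb ρ hδ)).2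
  -- Replacing w by y costs O(δ) here, hence O(δ²) after the factor δ of the expansion.
  have hgen : generator κ (fun θ => ⟪w, P θ w⟫_ℝ) ρ ≤ generator κ (fun θ => ⟪y, P θ y⟫_ℝ) ρ
      + 2 * (δ * (2 * K * b + T * K ^ 2 * b) * ‖y‖ ^ 2) * C := by
    have hint : ∀ v, Integrable (fun θ => ⟪v, P θ v⟫_ℝ - ⟪v, P ρ v⟫_ℝ) (κ ρ) := fun v =>
      (Integrable.of_bound (hPm v).aestronglyMeasurable (b * ‖v‖ ^ 2)
        (Eventually.of_forall (hbound v))).sub (integrable_const _)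
    have e : generator κ (fun θ => ⟪w, P θ w⟫_ℝ) ρ - generator κ (fun θ => ⟪y, P θ y⟫_ℝ) ρ =
        generator κ (fun θ => ⟪w, P θ w⟫_ℝ - ⟪y, P θ y⟫_ℝ) ρ := by
      unfold generator
      rw [← integral_sub (hint w) (hint y)]
      congr 1
      funext θ
      ring
    have := (abs_le.1 (abs_generator_le hC (f := fun θ => ⟪w, P θ w⟫_ℝ - ⟪y, P θ y⟫_ℝ)
      (c := δ * (2 * K * b + T * K ^ 2 * b) * ‖y‖ ^ 2) (fun θ => by
        have e1 : ⟪w, P θ w⟫_ℝ - ⟪y, P θ y⟫_ℝ =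
            δ * (⟪z, P θ y⟫_ℝ + ⟪y, P θ z⟫_ℝ + δ * ⟪z, P θ z⟫_ℝ) := by
          rw [hexp]
          ring
        rw [e1, abs_mul, abs_of_nonneg hδ, mul_assoc]
        refine mul_le_mul_of_nonneg_left ?_ hδ
        have h3 : |δ * ⟪z, P θ z⟫_ℝ| ≤ T * (b * K ^ 2 * ‖y‖ ^ 2) := by
          rw [abs_mul, abs_of_nonneg hδ]
          exact mul_le_mul hT (hzz θ) (abs_nonneg _) hT0
        refine (abs_add_le _ _).trans ((add_le_add (abs_add_le _ _) h3).trans ?_)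
        linarith [hzy θ, hyz θ]) ρ)).2
    linarith
  have hLy := mul_le_mul_of_nonneg_left (hL ρ y) hδ
  rw [mul_zero] at hLy
  have hgen' := mul_le_mul_of_nonneg_left hgen hδ
  -- The three terms come from the δ² term of `hexp`, from `hgen` and from `hsemi`.
  set D := b * K ^ 2 + 2 * (2 * K * b + T * K ^ 2 * b) * C + 4 * (b * (1 + T * K) ^ 2) * C ^ 2
    with hD
  have hD0 : 0 ≤ D := by positivity
  have hzz' := mul_le_mul_of_nonneg_left (abs_le.1 (hzz ρ)).2 (sq_nonneg δ)
  have hPy0 : 0 ≤ ⟪y, P ρ y⟫_ℝ := le_trans (by positivity) (hP ρ y)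
  calc ∫ θ, ⟪w, P θ w⟫_ℝ ∂(p δ ρ)
      ≤ (1 - 2 * α * δ) * ⟪y, P ρ y⟫_ℝ + D * δ ^ 2 * ‖y‖ ^ 2 := by
        rw [hexp ρ] at hsemi
        rw [hD]
        linarith
    -- Coercivity absorbs the remainder into V, making the estimate multiplicative and so iterable.
    _ ≤ (1 - 2 * α * δ) * ⟪y, P ρ y⟫_ℝ + D / ε * δ ^ 2 * ⟪y, P ρ y⟫_ℝ := by
        have : D * δ ^ 2 * ‖y‖ ^ 2 = D / ε * δ ^ 2 * (ε * ‖y‖ ^ 2) := by field_simp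
        rw [this]
        have := mul_le_mul_of_nonneg_left (hP ρ y) (show 0 ≤ D / ε * δ ^ 2 by positivity)
        linarith
    _ = (-2 * α * δ + D / ε * δ ^ 2 + 1) * ⟪y, P ρ y⟫_ℝ := by ring
    _ ≤ _ := mul_le_mul_of_nonneg_right (Real.add_one_le_exp _) hPy0

end Lyapunov

/-! ### Iteration over the grid and passage to the limit. -/

section Iteration

open scoped InnerProductSpace

lemma past_le {Ω E : Type*} [mΩ : MeasurableSpace Ω] [MeasurableSpace E] {ρ : ℝ → Ω → E}
    (hρ : ∀ t, 0 ≤ t → Measurable (ρ t)) (s : ℝ) : past ρ s ≤ mΩ :=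
  iSup₂_le fun r hr => (hρ r hr.1).comap_le

lemma past_mono {Ω E : Type*} [MeasurableSpace E] (ρ : ℝ → Ω → E) {s t : ℝ} (hst : s ≤ t) :
    past ρ s ≤ past ρ t :=
  biSup_mono fun _ hr => ⟨hr.1, hr.2.trans hst⟩

lemma measurable_past {Ω E : Type*} [MeasurableSpace E] (ρ : ℝ → Ω → E) {s : ℝ} (hs : 0 ≤ s) :
    Measurable[past ρ s] (ρ s) :=
  (comap_measurable (ρ s)).mono
    (le_iSup₂ (f := fun r (_ : r ∈ Set.Icc (0 : ℝ) s) => MeasurableSpace.comap (ρ r) inferInstance)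
      s ⟨hs, le_rfl⟩) le_rfl

/-- The Euler scheme is adapted to the filtration of the parameter. -/
lemma measurable_euler {Ω E V : Type*} [MeasurableSpace E] [NormedAddCommGroup V]
    [InnerProductSpace ℝ V] [MeasurableSpace V] [BorelSpace V] [SecondCountableTopology V]
    {B : E → V →L[ℝ] V} (hBm : Measurable fun q : E × V => B q.1 q.2)
    (ρ : ℝ → Ω → E) (x₀ : V) {δ : ℝ} (hδ : 0 ≤ δ) (k : ℕ) :
    Measurable[past ρ (k * δ)] fun ω => euler (fun s => B (ρ s ω)) x₀ δ k := by
  induction k with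
  | zero => exact measurable_const
  | succ k ih =>
    have hle : past ρ (k * δ) ≤ past ρ ((k + 1 : ℕ) * δ) :=
      past_mono ρ (by push_cast; nlinarith)
    have h1 : Measurable[past ρ ((k + 1 : ℕ) * δ)] (ρ (k * δ)) :=
      (measurable_past ρ (by positivity)).mono hle le_rfl
    have h2 := ih.mono hle le_rfl
    exact h2.add ((hBm.comp (h1.prodMk h2)).const_smul δ)

variable {Ω E V : Type*} [MeasurableSpace Ω] [MeasurableSpace E] [NormedAddCommGroup V]
  [InnerProductSpace ℝ V] [MeasurableSpace V] [BorelSpace V] [SecondCountableTopology V]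

/-- The iterate k + 1 is a function of iterate k and ρ(kδ), both known at time kδ. Only ρ((k+1)δ)
remains to be averaged, and `hstep` yields one factor a. -/
lemma integral_lyapunov_euler_le {μ : Measure Ω} [IsProbabilityMeasure μ] {B P : E → V →L[ℝ] V}
    (hBm : Measurable fun q : E × V => B q.1 q.2)
    (hPm : Measurable fun q : E × V => ⟪q.2, P q.1 q.2⟫_ℝ)
    {K b : ℝ} (hK : ∀ ρ, ‖B ρ‖ ≤ K) (hb : ∀ ρ, ‖P ρ‖ ≤ b) {ρ : ℝ → Ω → E}
    (hρ : ∀ t, 0 ≤ t → Measurable (ρ t)) {δ : ℝ} (hδ : 0 ≤ δ) {q : Kernel E E} [IsMarkovKernel q]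
    (hq : ∀ s, 0 ≤ s → ∀ D : Set E, MeasurableSet D →
      μ[(ρ (s + δ) ⁻¹' D).indicator (fun _ => (1 : ℝ)) | past ρ s]
        =ᵐ[μ] fun ω => (q (ρ s ω)).real D)
    {a : ℝ} (ha : 0 ≤ a)
    (hstep : ∀ ρ y, ∫ θ, ⟪y + δ • B ρ y, P θ (y + δ • B ρ y)⟫_ℝ ∂(q ρ) ≤ a * ⟪y, P ρ y⟫_ℝ)
    (x₀ : V) (k : ℕ) :
    Integrable (fun ω => ⟪euler (fun s => B (ρ s ω)) x₀ δ k,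
        P (ρ (k * δ) ω) (euler (fun s => B (ρ s ω)) x₀ δ k)⟫_ℝ) μ ∧
      ∫ ω, ⟪euler (fun s => B (ρ s ω)) x₀ δ k,
        P (ρ (k * δ) ω) (euler (fun s => B (ρ s ω)) x₀ δ k)⟫_ℝ ∂μ ≤ a ^ k * (b * ‖x₀‖ ^ 2) := by
  have hb0 : 0 ≤ b := by
    have := IsProbabilityMeasure.neZero μ
    obtain ⟨ω⟩ := μ.nonempty_of_neZero
    exact (norm_nonneg _).trans (hb (ρ 0 ω))
  have hint : ∀ k : ℕ, Integrable (fun ω => ⟪euler (fun s => B (ρ s ω)) x₀ δ k,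
      P (ρ (k * δ) ω) (euler (fun s => B (ρ s ω)) x₀ δ k)⟫_ℝ) μ := by
    intro k
    have hm : Measurable fun ω => euler (fun s => B (ρ s ω)) x₀ δ k :=
      (measurable_euler hBm ρ x₀ hδ k).mono (past_le hρ _) le_rfl
    refine Integrable.of_bound (C := b * (Real.exp (K * (k * δ)) * ‖x₀‖) ^ 2)
      (hPm.comp ((hρ (k * δ) (by positivity)).prodMk hm)).aestronglyMeasurable
      (Eventually.of_forall fun ω => ?_)
    refine (abs_inner_clm_le (hb _) _ _).trans ?_
    rw [mul_assoc, ← sq]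
    have := norm_euler_le (B := fun s => B (ρ s ω)) (fun t _ => hK _) x₀ hδ k
    gcongr
  refine ⟨hint k, ?_⟩
  induction k with
  | zero =>
    simp only [euler, pow_zero, one_mul]
    refine (integral_mono (hint 0) (integrable_const (b * ‖x₀‖ ^ 2)) fun ω => ?_).trans (by simp)
    refine (le_abs_self _).trans ((abs_inner_clm_le (hb _) _ _).trans (le_of_eq ?_))
    simp only [euler]
    ring
  | succ k ih =>
    have hk0 : 0 ≤ (k : ℝ) * δ := by positivity
    have hcast : ((k + 1 : ℕ) : ℝ) * δ = k * δ + δ := by push_cast; ring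
    have hi := hint (k + 1)
    rw [hcast] at hi ⊢
    have hBm' : Measurable fun z : V × E => B z.2 z.1 := hBm.comp measurable_swap
    have hGm : Measurable fun z : (V × E) × E =>
        ⟪z.1.1 + δ • B z.1.2 z.1.1, P z.2 (z.1.1 + δ • B z.1.2 z.1.1)⟫_ℝ :=
      hPm.comp (measurable_snd.prodMk ((measurable_fst.comp measurable_fst).add
        ((hBm'.comp measurable_fst).const_smul δ)))
    have := integral_le_of_kernel_le (past_le hρ (k * δ)) (measurable_euler hBm ρ x₀ hδ k)
      (measurable_past ρ hk0) (hρ (k * δ + δ) (by linarith)) (hq _ hk0) hGm hi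
      (H := fun z => a * ⟪z.1, P z.2 z.1⟫_ℝ) ((hint k).const_mul a) fun y r => hstep r y
    refine this.trans ?_
    rw [integral_const_mul, pow_succ', mul_assoc]
    exact mul_le_mul_of_nonneg_left ih ha

/-- A Lyapunov function of the pair `(x, ρ)` bounds the second moment of `x`. -/
lemma integral_norm_sq_le [MeasurableSingletonClass E]
    {p : ℝ → Kernel E E} {κ : E → Measure E} [∀ ρ, IsFiniteMeasure (κ ρ)]
    (hp : ∀ t, 0 ≤ t → IsMarkovKernel (p t)) (hp0 : p 0 = Kernel.id)
    (hck : ∀ s t, 0 ≤ s → 0 ≤ t → p (s + t) = p t ∘ₖ p s)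
    (hrate : ∀ (ρ : E) (B : Set E), MeasurableSet B → ρ ∉ B →
      (fun h : ℝ => (p h ρ).real B - (κ ρ).real B * h) =o[𝓝[>] (0 : ℝ)] (fun h : ℝ => h))
    {C : ℝ} (hC : ∀ ρ, (κ ρ).real Set.univ ≤ C)
    {B P : E → V →L[ℝ] V} (hBm : Measurable fun q : E × V => B q.1 q.2)
    (hPm : Measurable fun q : E × V => ⟪q.2, P q.1 q.2⟫_ℝ)
    {K b ε α : ℝ} (hε : 0 < ε) (hK : ∀ ρ, ‖B ρ‖ ≤ K) (hb : ∀ ρ, ‖P ρ‖ ≤ b)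
    (hP : ∀ ρ v, ε * ‖v‖ ^ 2 ≤ ⟪v, P ρ v⟫_ℝ)
    (hL : ∀ ρ v, ⟪B ρ v, P ρ v⟫_ℝ + ⟪v, P ρ (B ρ v)⟫_ℝ + generator κ (fun θ => ⟪v, P θ v⟫_ℝ) ρ
      + 2 * α * ⟪v, P ρ v⟫_ℝ ≤ 0)
    {μ : Measure Ω} [IsProbabilityMeasure μ] {ρ : ℝ → Ω → E} {x : ℝ → Ω → V} {x₀ : V}
    (hρ : ∀ t, 0 ≤ t → Measurable (ρ t)) (hxm : ∀ t, 0 ≤ t → Measurable (x t))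
    (hx0 : ∀ᵐ ω ∂μ, x 0 ω = x₀)
    (hpc : ∀ᵐ ω ∂μ, IsPiecewiseConstant fun t => ρ t ω)
    (hq : ∀ s h, 0 ≤ s → 0 ≤ h → ∀ D : Set E, MeasurableSet D →
      μ[(ρ (s + h) ⁻¹' D).indicator (fun _ => (1 : ℝ)) | past ρ s]
        =ᵐ[μ] fun ω => (p h (ρ s ω)).real D)
    (hxc : ∀ᵐ ω ∂μ, ContinuousOn (fun t => x t ω) (Set.Ici 0))
    (hflow : ∀ᵐ ω ∂μ, ∀ t, 0 ≤ t →
      HasDerivWithinAt (fun s => x s ω) (B (ρ t ω) (x t ω)) (Set.Ici t) t)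
    {t : ℝ} (ht : 0 ≤ t) :
    Integrable (fun ω => ‖x t ω‖ ^ 2) μ ∧
      ∫ ω, ‖x t ω‖ ^ 2 ∂μ ≤ b / ε * Real.exp (-2 * α * t) * ‖x₀‖ ^ 2 := by
  have hlim : ∀ᵐ ω ∂μ, Tendsto
      (fun m : ℕ => ‖euler (fun s => B (ρ s ω)) x₀ (t / (m + 1 : ℕ)) (m + 1)‖ ^ 2) atTop
      (𝓝 (‖x t ω‖ ^ 2)) := by
    filter_upwards [hx0, hpc, hxc, hflow] with ω h0 h1 h2 h3
    rw [← h0]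
    exact ((tendsto_euler hK h1 h2 h3 ht).norm).pow 2
  have hδ0 : ∀ m : ℕ, 0 ≤ t / (m + 1 : ℕ) := fun m => by positivity
  have hmδ : ∀ m : ℕ, ((m + 1 : ℕ) : ℝ) * (t / (m + 1 : ℕ)) = t := fun m => by field_simp
  have hbd : ∀ (m : ℕ) ω, ‖‖euler (fun s => B (ρ s ω)) x₀ (t / (m + 1 : ℕ)) (m + 1)‖ ^ 2‖ ≤
      (Real.exp (K * t) * ‖x₀‖) ^ 2 := by
    intro m ω
    rw [Real.norm_of_nonneg (sq_nonneg _)]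
    have := norm_euler_le (B := fun s => B (ρ s ω)) (fun t _ => hK _) x₀ (hδ0 m) (m + 1)
    rw [hmδ] at this
    gcongr
  have hmeas : ∀ m : ℕ, Measurable fun ω =>
      ‖euler (fun s => B (ρ s ω)) x₀ (t / (m + 1 : ℕ)) (m + 1)‖ ^ 2 := fun m =>
    (((measurable_euler hBm ρ x₀ (hδ0 m) (m + 1)).mono (past_le hρ _) le_rfl).norm).pow_const 2
  refine ⟨Integrable.of_bound (C := (Real.exp (K * t) * ‖x₀‖) ^ 2)
    ((hxm t ht).norm.pow_const 2).aestronglyMeasurable ?_, ?_⟩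
  · filter_upwards [hlim] with ω hω
    exact le_of_tendsto hω.norm (Eventually.of_forall fun m => hbd m ω)
  have hconv := tendsto_integral_of_dominated_convergence
    (fun _ => (Real.exp (K * t) * ‖x₀‖) ^ 2) (fun m => (hmeas m).aestronglyMeasurable)
    (integrable_const _) (fun m => Eventually.of_forall (hbd m)) hlim
  -- The one-step constant with T = t, admissible for every m since t / (m + 1) ≤ t.
  set D := (b * K ^ 2 + 2 * (2 * K * b + t * K ^ 2 * b) * C
    + 4 * (b * (1 + t * K) ^ 2) * C ^ 2) / ε with hD
  have hstep : ∀ m : ℕ, ∫ ω, ‖euler (fun s => B (ρ s ω)) x₀ (t / (m + 1 : ℕ)) (m + 1)‖ ^ 2 ∂μ ≤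
      b / ε * Real.exp (-2 * α * t + D * t * (t / (m + 1 : ℕ))) * ‖x₀‖ ^ 2 := by
    intro m
    set δ := t / (m + 1 : ℕ) with hδ
    have := hp δ (hδ0 m)
    have hδt : δ ≤ t := by
      rw [hδ]
      exact div_le_self ht (by push_cast; linarith [Nat.cast_nonneg (α := ℝ) m])
    obtain ⟨hi, hle⟩ := integral_lyapunov_euler_le hBm hPm hK hb hρ (hδ0 m)
      (fun s hs => hq s δ hs (hδ0 m)) (Real.exp_pos (-2 * α * δ + D * δ ^ 2)).le
      (fun r y => integral_lyapunov_step_le hp hp0 hck hrate hC hε hK hb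
        (fun v => hPm.comp (measurable_id.prodMk measurable_const)) hP hL (hδ0 m) hδt r y)
      x₀ (m + 1)
    have hexp : Real.exp (-2 * α * δ + D * δ ^ 2) ^ (m + 1) =
        Real.exp (-2 * α * t + D * t * δ) := by
      rw [← Real.exp_nat_mul]
      congr 1
      calc ((m + 1 : ℕ) : ℝ) * (-2 * α * δ + D * δ ^ 2)
          = -2 * α * (((m + 1 : ℕ) : ℝ) * δ) + D * (((m + 1 : ℕ) : ℝ) * δ) * δ := by ring
        _ = _ := by rw [hmδ]
    rw [hexp] at hle
    have h1 : ∫ ω, ‖euler (fun s => B (ρ s ω)) x₀ δ (m + 1)‖ ^ 2 ∂μ ≤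
        ε⁻¹ * ∫ ω, ⟪euler (fun s => B (ρ s ω)) x₀ δ (m + 1),
          P (ρ ((m + 1 : ℕ) * δ) ω) (euler (fun s => B (ρ s ω)) x₀ δ (m + 1))⟫_ℝ ∂μ := by
      rw [← integral_const_mul]
      refine integral_mono (Integrable.of_bound (hmeas m).aestronglyMeasurable _
        (Eventually.of_forall (hbd m))) (hi.const_mul _) fun ω => ?_
      rw [← div_eq_inv_mul, le_div_iff₀ hε, mul_comm]
      exact hP _ _
    refine h1.trans ((mul_le_mul_of_nonneg_left hle (inv_pos.2 hε).le).trans (le_of_eq ?_))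
    rw [div_eq_inv_mul]
    ring
  refine le_of_tendsto_of_tendsto' hconv ?_ hstep
  have hlim0 : Tendsto (fun m : ℕ => t / ((m + 1 : ℕ) : ℝ)) atTop (𝓝 0) :=
    (tendsto_const_div_atTop_nhds_zero_nat t).comp (tendsto_add_atTop_nat 1)
  have h2 : Tendsto (fun m : ℕ => -2 * α * t + D * t * (t / ((m + 1 : ℕ) : ℝ))) atTop
      (𝓝 (-2 * α * t)) := by
    simpa using (hlim0.const_mul (D * t)).const_add (-2 * α * t)
  exact (((Real.continuous_exp.tendsto _).comp h2).const_mul (b / ε)).mul_const (‖x₀‖ ^ 2)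

end Iteration

/-! ### From sums of squares to matrix inequalities. -/

section Polynomial

variable {N n M : ℕ}

lemma continuous_evalMat {m k : Type*} (P : Matrix m k (MvPolynomial (Fin N) ℝ)) :
    Continuous (evalMat P) :=
  continuous_matrix fun i j => MvPolynomial.continuous_eval (P i j)

lemma continuous_evalRate (lam : MvPolynomial (Fin N ⊕ Fin N) ℝ) :
    Continuous fun z : (Fin N → ℝ) × (Fin N → ℝ) => evalRate lam z.1 z.2 := by
  refine (MvPolynomial.continuous_eval lam).comp (continuous_pi fun i => ?_)
  rcases i with i | i
  · exact (continuous_apply i).comp continuous_fst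
  · exact (continuous_apply i).comp continuous_snd

lemma continuous_evalRate_right (lam : MvPolynomial (Fin N ⊕ Fin N) ℝ) (ρ : Fin N → ℝ) :
    Continuous fun θ => evalRate lam ρ θ := by
  refine (MvPolynomial.continuous_eval lam).comp (continuous_pi fun i => ?_)
  rcases i with i | i
  · exact continuous_const
  · exact continuous_apply i

lemma IsSOS.posSemidef {F : (Fin N → ℝ) → Matrix (Fin n) (Fin n) ℝ} (h : IsSOS F)
    (ρ : Fin N → ℝ) : (F ρ).PosSemidef := by
  obtain ⟨k, L, hL⟩ := h
  rw [hL ρ, ← conjTranspose_eq_transpose_of_trivial]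
  exact posSemidef_conjTranspose_mul_self _

lemma integrableOn_rate_mul_sub {S : Set (Fin N → ℝ)} (hS : IsCompact S)
    (lam : MvPolynomial (Fin N ⊕ Fin N) ℝ) (P : Matrix (Fin n) (Fin n) (MvPolynomial (Fin N) ℝ))
    (ρ : Fin N → ℝ) (i j : Fin n) :
    IntegrableOn (fun θ => evalRate lam ρ θ * (evalMat P θ i j - evalMat P ρ i j)) S :=
  ((continuous_evalRate_right lam ρ).mul
    (((continuous_evalMat P).matrix_elem i j).sub continuous_const)).continuousOn.integrableOn_compact
    hS

lemma posSemidef_sum_smul {g : Fin M → MvPolynomial (Fin N) ℝ} {ρ : Fin N → ℝ}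
    (hρ : ρ ∈ semialgebraicSet g) {Γ : Fin M → Matrix (Fin n) (Fin n) (MvPolynomial (Fin N) ℝ)}
    (hΓ : ∀ i, IsSOS (evalMat (Γ i))) :
    (∑ i, MvPolynomial.eval ρ (g i) • evalMat (Γ i) ρ).PosSemidef :=
  posSemidef_sum _ fun i _ => ((hΓ i).posSemidef ρ).smul (hρ i)

variable {g : Fin M → MvPolynomial (Fin N) ℝ}
  {A : Matrix (Fin n) (Fin n) (MvPolynomial (Fin N) ℝ)}
  {lam : MvPolynomial (Fin N ⊕ Fin N) ℝ} {ε α : ℝ}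
  {P : Matrix (Fin n) (Fin n) (MvPolynomial (Fin N) ℝ)}
  {Γ₁ Γ₂ : Fin M → Matrix (Fin n) (Fin n) (MvPolynomial (Fin N) ℝ)}

/-- The uniform margin ε, which pointwise positive definiteness does not record, is the coercivity
constant of V. -/
lemma SOSFeasible.posSemidef_sub (h : SOSFeasible g A lam ε α P Γ₁ Γ₂) {ρ : Fin N → ℝ}
    (hρ : ρ ∈ semialgebraicSet g) :
    (evalMat P ρ - ε • (1 : Matrix (Fin n) (Fin n) ℝ)).PosSemidef := by
  have := (h.c2.posSemidef ρ).add (posSemidef_sum_smul hρ fun i => (h.c1 i).1)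
  convert this using 1
  abel

lemma SOSFeasible.lyapunovCondition (h : SOSFeasible g A lam ε α P Γ₁ Γ₂) (hε : 0 < ε)
    (hS : IsCompact (semialgebraicSet g)) :
    LyapunovCondition (semialgebraicSet g) A lam α (evalMat P) := by
  intro ρ hρ
  refine ⟨?_, integrableOn_rate_mul_sub hS lam P ρ, ?_⟩
  · have := (PosDef.one (n := Fin n) (R := ℝ)).smul hε |>.add_posSemidef (h.posSemidef_sub hρ)
    convert this using 1
    abel
  · have := (h.c3.posSemidef ρ).add (posSemidef_sum_smul hρ fun i => (h.c1 i).2)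
    convert this using 1
    abel

end Polynomial

/-! ### The rate polynomial as a finite jump measure. -/

section JumpKernel

variable {N n : ℕ} {S : Set (Fin N → ℝ)} (lam : MvPolynomial (Fin N ⊕ Fin N) ℝ)

/-- The jump measure `lam(ρ, θ) dθ` on `S`. -/
noncomputable def jumpMeasure (S : Set (Fin N → ℝ)) (lam : MvPolynomial (Fin N ⊕ Fin N) ℝ)
    (ρ : S) : Measure S :=
  (volume.withDensity fun θ => ENNReal.ofReal (evalRate lam ρ θ)).comap Subtype.val

lemma jumpMeasure_apply (hS : MeasurableSet S) (ρ : S) {B : Set S} (hB : MeasurableSet B) :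
    jumpMeasure S lam ρ B = ∫⁻ θ in Subtype.val '' B, ENNReal.ofReal (evalRate lam ρ θ) := by
  rw [jumpMeasure, (MeasurableEmbedding.subtype_coe hS).comap_apply,
    withDensity_apply _ ((MeasurableEmbedding.subtype_coe hS).measurableSet_image.2 hB)]

/-- The rate is continuous, hence bounded on the compact S × S, and S has finite volume. -/
lemma exists_jumpMeasure_le (hS : IsCompact S) :
    ∃ C : NNReal, ∀ ρ : S, jumpMeasure S lam ρ Set.univ ≤ C := by
  obtain ⟨L, hL⟩ := (hS.prod hS).exists_bound_of_continuousOn (continuous_evalRate lam).continuousOn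
  refine ⟨(ENNReal.ofReal L * volume S).toNNReal, fun ρ => ?_⟩
  rw [ENNReal.coe_toNNReal (ENNReal.mul_ne_top ENNReal.ofReal_ne_top hS.measure_lt_top.ne),
    jumpMeasure_apply lam hS.measurableSet ρ MeasurableSet.univ, Set.image_univ,
    Subtype.range_coe, ← setLIntegral_const]
  exact setLIntegral_mono measurable_const fun θ hθ =>
    ENNReal.ofReal_le_ofReal ((le_abs_self _).trans (hL (ρ, θ) ⟨ρ.2, hθ⟩))

/-- `ENNReal.ofReal` truncates negative rates, which occur only on a null subset of S. -/
lemma jumpMeasure_real (hS : MeasurableSet S)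
    (hlam : ∀ ρ ∈ S, ∀ᵐ θ ∂(volume.restrict S), 0 ≤ evalRate lam ρ θ) (ρ : S) {B : Set S}
    (hB : MeasurableSet B) : (jumpMeasure S lam ρ).real B = jumpRate S lam ρ B := by
  rw [measureReal_def, jumpMeasure_apply lam hS ρ hB, jumpRate, integral_eq_lintegral_of_nonneg_ae]
  · exact ae_restrict_of_ae_restrict_of_subset (Subtype.coe_image_subset S B) (hlam ρ ρ.2)
  · exact (continuous_evalRate_right lam ρ).aestronglyMeasurable

lemma integral_jumpMeasure (hS : MeasurableSet S)
    (hlam : ∀ ρ ∈ S, ∀ᵐ θ ∂(volume.restrict S), 0 ≤ evalRate lam ρ θ) (ρ : S)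
    (f : (Fin N → ℝ) → ℝ) :
    ∫ θ, f θ ∂(jumpMeasure S lam ρ) = ∫ θ in S, evalRate lam ρ θ * f θ := by
  rw [jumpMeasure, integral_subtype_comap hS, setIntegral_withDensity_eq_setIntegral_toReal_smul]
  · refine integral_congr_ae ((hlam ρ ρ.2).mono fun θ h => ?_)
    simp [h]
  · exact (continuous_evalRate_right lam ρ).measurable.ennreal_ofReal
  · exact Eventually.of_forall fun _ => ENNReal.ofReal_lt_top
  · exact hS

lemma generator_jumpMeasure (hS : IsCompact S)
    (hlam : ∀ ρ ∈ S, ∀ᵐ θ ∂(volume.restrict S), 0 ≤ evalRate lam ρ θ)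
    (P : Matrix (Fin n) (Fin n) (MvPolynomial (Fin N) ℝ)) (ρ : S) (v : Fin n → ℝ) :
    generator (jumpMeasure S lam) (fun θ => v ⬝ᵥ evalMat P θ *ᵥ v) ρ =
      v ⬝ᵥ jumpIntegral S lam (evalMat P) ρ *ᵥ v := by
  unfold generator
  rw [integral_jumpMeasure lam hS.measurableSet hlam ρ
    (fun θ => v ⬝ᵥ evalMat P θ *ᵥ v - v ⬝ᵥ evalMat P ρ *ᵥ v)]
  have e : ∀ θ, evalRate lam ρ θ * (v ⬝ᵥ evalMat P θ *ᵥ v - v ⬝ᵥ evalMat P ρ *ᵥ v) =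
      ∑ i, ∑ j, v i * (evalRate lam ρ θ * (evalMat P θ i j - evalMat P ρ i j)) * v j := by
    intro θ
    simp only [dotProduct, mulVec, Finset.mul_sum, ← Finset.sum_sub_distrib]
    exact Finset.sum_congr rfl fun i _ => Finset.sum_congr rfl fun j _ => by ring
  have hi : ∀ i j, Integrable (fun θ =>
      v i * (evalRate lam ρ θ * (evalMat P θ i j - evalMat P ρ i j)) * v j) (volume.restrict S) :=
    fun i j => ((integrableOn_rate_mul_sub hS lam P ρ i j).integrable.const_mul _).mul_const _
  simp only [e]
  rw [integral_finsetSum _ fun i _ => integrable_finsetSum _ fun j _ => hi i j]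
  simp only [dotProduct, mulVec, Finset.mul_sum, jumpIntegral, of_apply]
  refine Finset.sum_congr rfl fun i _ => ?_
  rw [integral_finsetSum _ fun j _ => hi i j]
  refine Finset.sum_congr rfl fun j _ => ?_
  rw [integral_mul_const, integral_const_mul]
  ring

end JumpKernel

end LPVJump

/-! ### Assembly of the theorem. -/

theorem mainTheorem4 {N n M : ℕ} (g : Fin M → MvPolynomial (Fin N) ℝ)
    (hcompact : IsCompact (LPVJump.semialgebraicSet g))
    (A : Matrix (Fin n) (Fin n) (MvPolynomial (Fin N) ℝ))
    (lam : MvPolynomial (Fin N ⊕ Fin N) ℝ)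
    (hlam : ∀ ρ ∈ LPVJump.semialgebraicSet g,
      ∀ᵐ θ ∂(volume.restrict (LPVJump.semialgebraicSet g)), 0 ≤ LPVJump.evalRate lam ρ θ)
    (ε α : ℝ) (hε : 0 < ε) (hα : 0 < α)
    (P : Matrix (Fin n) (Fin n) (MvPolynomial (Fin N) ℝ))
    (Γ₁ Γ₂ : Fin M → Matrix (Fin n) (Fin n) (MvPolynomial (Fin N) ℝ))
    (hfeas : LPVJump.SOSFeasible g A lam ε α P Γ₁ Γ₂) :
    LPVJump.LyapunovCondition (LPVJump.semialgebraicSet g) A lam α (LPVJump.evalMat P) ∧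
      LPVJump.MeanSquareExpStable.{u} (LPVJump.semialgebraicSet g) A lam α := by
  open LPVJump in
  have hlyap := hfeas.lyapunovCondition hε hcompact
  refine ⟨hlyap, ?_⟩
  set S := semialgebraicSet g with hS
  obtain ⟨C, hC⟩ := exists_jumpMeasure_le lam hcompact
  have hfin : ∀ ρ, IsFiniteMeasure (jumpMeasure S lam ρ) := fun ρ =>
    ⟨(hC ρ).trans_lt ENNReal.coe_lt_top⟩
  have hCr : ∀ ρ, (jumpMeasure S lam ρ).real Set.univ ≤ C := fun ρ =>
    ENNReal.toReal_le_coe_of_le_coe (hC ρ)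
  have hclm : ∀ Q : Matrix (Fin n) (Fin n) (MvPolynomial (Fin N) ℝ),
      Continuous fun ρ => Matrix.toEuclideanCLM (𝕜 := ℝ) (evalMat Q ρ) := fun Q =>
    (LinearMap.continuous_of_finiteDimensional
      (Matrix.toEuclideanCLM (n := Fin n) (𝕜 := ℝ)).toAlgEquiv.toLinearMap).comp
      (continuous_evalMat Q)
  have happ : ∀ Q : Matrix (Fin n) (Fin n) (MvPolynomial (Fin N) ℝ),
      Continuous fun q : S × EuclideanSpace ℝ (Fin n) =>
        Matrix.toEuclideanCLM (𝕜 := ℝ) (evalMat Q q.1) q.2 := fun Q =>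
    ((hclm Q).comp (continuous_subtype_val.comp continuous_fst)).clm_apply continuous_snd
  obtain ⟨K, hK⟩ := hcompact.exists_bound_of_continuousOn (hclm A).continuousOn
  obtain ⟨b, hb⟩ := hcompact.exists_bound_of_continuousOn (hclm P).continuousOn
  -- V lies between ε‖x‖² and b‖x‖², whence b / ε. The maximum covers the degenerate cases n = 0 and
  -- S empty, where b / ε may be below 1.
  refine ⟨max 1 (b / ε), le_max_left _ _, ?_⟩
  intro Ω _ μ _ x₀ ρ₀ x ρ htraj t ht
  obtain ⟨p, hp, hmk⟩ := htraj.markov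
  have key := integral_norm_sq_le (κ := jumpMeasure S lam) (C := C)
    (B := fun ρ : S => Matrix.toEuclideanCLM (𝕜 := ℝ) (evalMat A ρ))
    (P := fun ρ : S => Matrix.toEuclideanCLM (𝕜 := ℝ) (evalMat P ρ)) (K := K) (b := b) (α := α)
    hp.markov hp.zero hp.chapman_kolmogorov
    (fun ρ B hB hρ => by
      rw [jumpMeasure_real lam hcompact.measurableSet hlam ρ hB]
      exact hp.rate ρ B hB hρ)
    hCr (happ A).measurable (continuous_snd.inner (happ P)).measurable hε
    (fun ρ => hK ρ ρ.2) (fun ρ => hb ρ ρ.2)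
    (fun ρ v => by
      have := (hfeas.posSemidef_sub ρ.2).dotProduct_mulVec_nonneg v.ofLp
      rw [inner_toEuclideanCLM, EuclideanSpace.real_norm_sq_eq]
      simp only [star_trivial, sub_mulVec, smul_mulVec, one_mulVec, dotProduct_sub,
        dotProduct_smul, smul_eq_mul] at this
      have e : v.ofLp ⬝ᵥ v.ofLp = ∑ i, v.ofLp i ^ 2 :=
        Finset.sum_congr rfl fun i _ => (sq _).symm
      rw [e] at this
      linarith)
    (fun ρ v => by
      have := ((hlyap ρ ρ.2).2.2).dotProduct_mulVec_nonneg v.ofLp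
      simp only [inner_toEuclideanCLM, ofLp_toEuclideanCLM]
      rw [generator_jumpMeasure lam hcompact hlam P ρ v.ofLp]
      -- Symmetry of P turns the transposed half of `He` into ⟨Av, Pv⟩.
      have hsymm : (evalMat P ρ)ᵀ = evalMat P ρ := by
        rw [evalMat, ← transpose_map, hfeas.symm]
      simp only [star_trivial, neg_mulVec, add_mulVec, smul_mulVec, He, dotProduct_neg,
        dotProduct_add, dotProduct_smul, smul_eq_mul, transpose_mul, hsymm] at this
      have e1 : v.ofLp ⬝ᵥ ((evalMat A ρ)ᵀ * evalMat P ρ) *ᵥ v.ofLp =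
          (evalMat A ρ *ᵥ v.ofLp) ⬝ᵥ evalMat P ρ *ᵥ v.ofLp := by
        rw [← mulVec_mulVec, dotProduct_mulVec, vecMul_transpose]
      rw [e1, ← mulVec_mulVec] at this
      linarith)
    htraj.measurable_param htraj.measurable_state htraj.init_state htraj.piecewise_constant hmk
    htraj.continuous_state htraj.flow ht
  refine ⟨key.1, key.2.trans ?_⟩
  gcongr
  exact le_max_right _ _
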